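/- Let $K\in\mathbb N$, let $\tilde h_1,\dots,\tilde h_K\in\mathbb C$ be fixed channel gains, let $\sigma_1,\sigma_2>0$, and let $\vec\rho=(\rho_1,\dots,\rho_K)\in[0,1]^K$ be power splitting ratios which, on the antennas with $\tilde h_k\neq 0$, are neither all equal to $0$ nor all equal to $1$ (if all gains are non-zero this says $\vec\rho\in[0,1]^K\setminus\{\vec 0,\vec 1\}$). Put $$\Theta_1=\sum_{k=1}^K\rho_k|\tilde h_k|^2,\qquad \Theta_2=\sum_{k=1}^K(1-\rho_k)^2|\tilde h_k|^4 .$$ Let $\tilde X\sim\mathcal{CN}(0,1)$, $\tilde Z\sim\mathcal{CN}(0,\sigma_1^2)$ and $N\sim\mathcal N(0,\sigma_2^2)$ be independent (here $\mathcal{CN}(0,v)$ is the circularly symmetric complex Gaussian law of total variance $v$). For $P>0$ consider the splitting channel with input $\sqrt P\tilde X$ and output $(\tilde Y_1,Y_2)\in\mathbb C\times\mathbb R$, $$\tilde Y_1=\sqrt{\Theta_1}\sqrt P\,\tilde X+\tilde Z,\qquad Y_2=\sqrt{\Theta_2}\,P\,|\tilde X|^2+N .$$ Let $\mathcal I(P)=\mathcal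 I(\sqrt P\tilde X;\tilde Y_1,Y_2)$ be the mutual information in bits, and let $$A(P)=\log_2\frac{\Theta_1P}{\sigma_1^2}+\frac{1}{2\ln 2}\,e^{c}\,\mathrm{Ei}(c),\quad c=\frac{\Theta_1\sigma_2^2}{2\Theta_2\sigma_1^2P},\qquad B(P)=\log_2\frac{\sqrt2\,P^{3/2}\sqrt{\Theta_1\Theta_2}}{\sigma_1\sigma_2}-\frac{\gamma}{2\ln2},$$ where $\mathrm{Ei}(x)=\int_x^\infty \frac{e^{-t}}{t}\,dt$ for $x>0$ and $\gamma$ is Euler's constant. Then $\mathcal I(P)<\infty$ for every $P>0$, and as $P\to\infty$ with all other parameters fixed, $$\mathcal I(P)-A(P)\to 0,\qquad A(P)-B(P)\to 0,\qquad \frac{\mathcal I(P)}{\log_2 P}\to\frac32 .$$ -/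

import Mathlib

open MeasureTheory ProbabilityTheory Filter Topology
open scoped NNReal ENNReal

namespace SplittingReceiver

/-- The circularly symmetric complex Gaussian law `𝒞𝒩(0, v)` of total variance `v`: real and
imaginary parts are independent real Gaussians with mean `0` and variance `v / 2`. -/
noncomputable def complexGaussian (v : ℝ≥0) : Measure ℂ :=
  ((gaussianReal 0 (v / 2)).prod (gaussianReal 0 (v / 2))).map
    (fun p : ℝ × ℝ => (⟨p.1, p.2⟩ : ℂ))

/-- Mutual information, in nats, of two random variables: the Kullback–Leibler divergence of their
joint law from the product of their marginal laws. The value may be `∞`. -/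
noncomputable def mutualInfo {Ω E F : Type*} [MeasurableSpace Ω] [MeasurableSpace E]
    [MeasurableSpace F] (μ : Measure Ω) (U : Ω → E) (V : Ω → F) : ℝ≥0∞ :=
  InformationTheory.klDiv (μ.map (fun ω => (U ω, V ω))) ((μ.map U).prod (μ.map V))

/-- A (finite) mutual information measured in bits. -/
noncomputable def mutualInfoBits {Ω E F : Type*} [MeasurableSpace Ω] [MeasurableSpace E]
    [MeasurableSpace F] (μ : Measure Ω) (U : Ω → E) (V : Ω → F) : ℝ :=
  (mutualInfo μ U V).toReal / Real.log 2

/-- The gain `Θ₁ = ∑ₖ ρₖ |hₖ|²` of the coherently processed signal. -/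
noncomputable def Θ₁ {K : ℕ} (ρ : Fin K → ℝ) (h : Fin K → ℂ) : ℝ :=
  ∑ k, ρ k * ‖h k‖ ^ 2

/-- The gain `Θ₂ = ∑ₖ (1 - ρₖ)² |hₖ|⁴` of the non-coherently processed signal. -/
noncomputable def Θ₂ {K : ℕ} (ρ : Fin K → ℝ) (h : Fin K → ℂ) : ℝ :=
  ∑ k, (1 - ρ k) ^ 2 * ‖h k‖ ^ 4

/-- The input `√P X` of the splitting channel at received signal power `P`. -/
noncomputable def channelInput {Ω : Type*} (P : ℝ) (X : Ω → ℂ) (ω : Ω) : ℂ :=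
  (Real.sqrt P : ℂ) * X ω

/-- The output `(Y₁, Y₂) = (√Θ₁ √P X + Z, √Θ₂ P |X|² + N)` of the splitting channel. -/
noncomputable def channelOutput {K : ℕ} {Ω : Type*} (ρ : Fin K → ℝ) (h : Fin K → ℂ) (P : ℝ)
    (X Z : Ω → ℂ) (N : Ω → ℝ) (ω : Ω) : ℂ × ℝ :=
  ((Real.sqrt (Θ₁ ρ h) : ℂ) * (Real.sqrt P : ℂ) * X ω + Z ω,
    Real.sqrt (Θ₂ ρ h) * P * ‖X ω‖ ^ 2 + N ω)

/-- The exponential integral `Ei(x) = ∫_x^∞ e^{-t} / t dt`, used for `x > 0`, where the integral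
converges. -/
noncomputable def Ei (x : ℝ) : ℝ :=
  ∫ t in Set.Ioi x, Real.exp (-t) / t

/-- The argument `c = Θ₁ σ₂² / (2 Θ₂ σ₁² P)` of the exponential integral. -/
noncomputable def eiArg {K : ℕ} (ρ : Fin K → ℝ) (h : Fin K → ℂ) (σ₁ σ₂ : ℝ≥0) (P : ℝ) : ℝ :=
  Θ₁ ρ h * (σ₂ : ℝ) ^ 2 / (2 * Θ₂ ρ h * (σ₁ : ℝ) ^ 2 * P)

/-- The approximation `log₂ (Θ₁ P / σ₁²) + e^c Ei(c) / (2 ln 2)`. -/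
noncomputable def approxEi {K : ℕ} (ρ : Fin K → ℝ) (h : Fin K → ℂ) (σ₁ σ₂ : ℝ≥0) (P : ℝ) : ℝ :=
  Real.logb 2 (Θ₁ ρ h * P / (σ₁ : ℝ) ^ 2)
    + 1 / (2 * Real.log 2) * Real.exp (eiArg ρ h σ₁ σ₂ P) * Ei (eiArg ρ h σ₁ σ₂ P)

/-- The approximation `log₂ (√2 P^{3/2} √(Θ₁ Θ₂) / (σ₁ σ₂)) - γ / (2 ln 2)`. -/
noncomputable def approxLog {K : ℕ} (ρ : Fin K → ℝ) (h : Fin K → ℂ) (σ₁ σ₂ : ℝ≥0) (P : ℝ) : ℝ :=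
  Real.logb 2
      (Real.sqrt 2 * P ^ (3 / 2 : ℝ) * Real.sqrt (Θ₁ ρ h * Θ₂ ρ h) / ((σ₁ : ℝ) * (σ₂ : ℝ)))
    - Real.eulerMascheroniConstant / (2 * Real.log 2)

end SplittingReceiver

/-! The mutual information is squeezed between two bounds, each obtained by replacing an intractable
conditional law by an explicit Gaussian one. Write `α = √Θ₁`, `β = √Θ₂`, `s = σ₁²`, `t = σ₂²`, `ε =
1/√P`.

Upper bound (`klDiv_channelLaw_le`). For every output law `Q`, the mutual information is at most the
mean log-ratio of the transition density to `Q`. Take `Q` with first component `𝒞𝒩(0, α²P)` and,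
given the first component `y`, second component Gaussian with mean `(β/α²)‖y‖²` and variance `t +
k‖y‖²`. Here `k = 2β²s/α⁴` is the value for which `k‖y‖²` is the variance of the linearised error
made by predicting `β‖u‖²` from `y = αu + z`. The log-ratio is `log (α²P/s) + ½ log (1 + ‖X‖²/c)`
plus a residual. Since `‖X‖²` is exponential, `exp_mul_Ei` turns the mean of the main part into
`approxEi` (times `log 2`). The residual has mean tending to `0` by dominated convergence
(`tendsto_integral_upperResidual`).

Lower bound (`le_klDiv_channelLaw`). By the Donsker–Varadhan inequality, any conditional subdensity
of the input given the output bounds the mutual information from below. The one used is Gaussian in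
polar coordinates: given `y`, the quantity `β‖u‖²` is centred at `y.2` with variance `t`, and the
phase of `u` relative to `y.1` is centred at `0` with variance `s/(2α²‖u‖²)`. Its mean log-ratio to
the input density is `approxLog` (times `log 2`) plus `½` minus the mean phase penalty, and that
penalty tends to `½` (`tendsto_integral_phasePenalty`). The inequality needs a finite divergence,
which the upper bound supplies.

The bounds meet because `e^c Ei(c) + log c → -γ` as `c → 0` (`tendsto_exp_mul_Ei_add_log`), so
`approxEi` and `approxLog` agree in the limit. The pre-log `3/2` is read off from `approxLog`. -/

namespace SplittingReceiver

open InformationTheory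

/-! ### Divergence bounds from auxiliary laws -/

/-- Kullback–Leibler divergence is invariant under exchanging the factors of a product space. -/
lemma klDiv_map_swap {E F : Type*} [MeasurableSpace E] [MeasurableSpace F]
    (μ ν : Measure (E × F)) [IsFiniteMeasure μ] [IsFiniteMeasure ν] :
    klDiv (μ.map Prod.swap) (ν.map Prod.swap) = klDiv μ ν := by
  refine le_antisymm (klDiv_map_le _ _ measurable_swap) ?_
  have h := klDiv_map_le (μ.map Prod.swap) (ν.map Prod.swap)
    (g := (Prod.swap : F × E → E × F)) measurable_swap
  have e : ((Prod.swap : F × E → E × F) ∘ (Prod.swap : E × F → F × E)) = id := by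
    funext p; simp
  rwa [Measure.map_map measurable_swap measurable_swap,
    Measure.map_map measurable_swap measurable_swap, e, Measure.map_id, Measure.map_id] at h

/-- Replacing the second marginal by an arbitrary law can only increase the divergence. -/
lemma klDiv_prod_snd_le {E F : Type*} [MeasurableSpace E] [MeasurableSpace F]
    [StandardBorelSpace E] [Nonempty E] (J : Measure (E × F)) [IsProbabilityMeasure J]
    (ν : Measure E) [IsProbabilityMeasure ν] (Q : Measure F) [IsProbabilityMeasure Q] :
    klDiv J (ν.prod J.snd) ≤ klDiv J (ν.prod Q) := by
  rw [← klDiv_map_swap J (ν.prod J.snd), ← klDiv_map_swap J (ν.prod Q), Measure.prod_swap,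
    Measure.prod_swap]
  have hp : IsProbabilityMeasure (J.map Prod.swap) :=
    Measure.isProbabilityMeasure_map measurable_swap.aemeasurable
  have h1 : (J.map Prod.swap).fst = J.snd := Measure.fst_map_swap
  -- Chain rule: the divergence from `ν.prod Q` is the divergence from `ν.prod J.snd` plus that of
  -- `J.snd` from `Q`. The swap puts the `F` coordinate first, where the composition-product form
  -- needs it.
  have h := klDiv_compProd_eq_add (J.map Prod.swap).fst Q (J.map Prod.swap).condKernel
    (Kernel.const F ν)
  rw [Measure.compProd_const, Measure.compProd_const, (J.map Prod.swap).disintegrate, h1] at h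
  rw [h]
  exact le_add_self

/-- Bound on mutual information from an auxiliary output law. -/
lemma klDiv_prod_snd_le_integral {E F : Type*} [MeasurableSpace E] [MeasurableSpace F]
    [StandardBorelSpace E] [Nonempty E] (J : Measure (E × F)) [IsProbabilityMeasure J]
    (ν : Measure E) [IsProbabilityMeasure ν] (Q : Measure F) [IsProbabilityMeasure Q]
    {l : E × F → ℝ} (hl : Measurable l)
    (hJ : J = (ν.prod Q).withDensity fun p => ENNReal.ofReal (Real.exp (l p)))
    (hint : Integrable l J) :
    klDiv J (ν.prod J.snd) ≠ ∞ ∧ (klDiv J (ν.prod J.snd)).toReal ≤ ∫ p, l p ∂J := by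
  have hac : J ≪ ν.prod Q := by rw [hJ]; exact withDensity_absolutelyContinuous _ _
  have hm : Measurable fun p => ENNReal.ofReal (Real.exp (l p)) := by fun_prop
  have hllr : llr J (ν.prod Q) =ᵐ[J] l := by
    have h := Measure.rnDeriv_withDensity (ν.prod Q) hm
    rw [← hJ] at h
    filter_upwards [hac.ae_le h] with p hp
    simp only [llr, hp]
    rw [ENNReal.toReal_ofReal (Real.exp_pos _).le, Real.log_exp]
  have hi : Integrable (llr J (ν.prod Q)) J := hint.congr hllr.symm
  have hfin : klDiv J (ν.prod Q) ≠ ∞ := klDiv_ne_top hac hi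
  have hle := klDiv_prod_snd_le J ν Q
  refine ⟨ne_top_of_le_ne_top hfin hle, (ENNReal.toReal_mono hfin hle).trans ?_⟩
  rw [toReal_klDiv_of_measure_eq hac (by simp), integral_congr_ae hllr]

/-- A form of the Donsker–Varadhan inequality. -/
lemma integral_le_toReal_klDiv {E : Type*} [MeasurableSpace E] (J ν : Measure E)
    [IsProbabilityMeasure J] [IsProbabilityMeasure ν] (hfin : klDiv J ν ≠ ∞)
    {l : E → ℝ} (hl : Measurable l) (hint : Integrable l J)
    (hexp : ∫⁻ p, ENNReal.ofReal (Real.exp (l p)) ∂ν ≤ 1) :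
    ∫ p, l p ∂J ≤ (klDiv J ν).toReal := by
  obtain ⟨hac, hllr⟩ := klDiv_ne_top_iff.1 hfin
  have he : Integrable (fun p => Real.exp (l p)) ν := by
    refine ⟨by fun_prop, ?_⟩
    rw [hasFiniteIntegral_iff_ofReal (ae_of_all _ fun p => (Real.exp_pos _).le)]
    exact hexp.trans_lt ENNReal.one_lt_top
  have hle1 : ∫ p, Real.exp (l p) ∂ν ≤ 1 := by
    rw [integral_eq_lintegral_of_nonneg_ae (ae_of_all _ fun p => (Real.exp_pos _).le) (by fun_prop)]
    exact ENNReal.toReal_le_of_le_ofReal zero_le_one (by simpa using hexp)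
  -- Nonnegativity of the divergence of `J` from the tilted law `e^l ν / ∫ e^l dν`, expanded, is the
  -- claim up to the term `log ∫ e^l dν ≤ 0`.
  have hp : IsProbabilityMeasure (ν.tilted l) := isProbabilityMeasure_tilted he
  have hact : J ≪ ν.tilted l := hac.trans (absolutelyContinuous_tilted he)
  have h0 := integral_llr_add_sub_measure_univ_nonneg hact
    (integrable_llr_tilted_right hac hint hllr he)
  rw [integral_llr_tilted_right hac hint he hllr] at h0
  rw [toReal_klDiv_of_measure_eq hac (by simp)]
  have hlog : Real.log (∫ p, Real.exp (l p) ∂ν) ≤ 0 :=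
    Real.log_nonpos (integral_nonneg fun p => (Real.exp_pos _).le) hle1
  simp only [probReal_univ] at h0
  linarith

/-- The joint law of the input and the output of an additive noise channel, relative to the product
of the input law with an auxiliary output law. -/
lemma map_additive_noise_eq_withDensity {E F : Type*} [MeasurableSpace E] [MeasurableSpace F]
    [AddGroup F] [MeasurableAdd₂ F] [MeasurableNeg F] (lam : Measure F) [SFinite lam]
    [lam.IsAddLeftInvariant]
    (ν : Measure E) [SFinite ν] {f q : F → ℝ≥0∞} {L : E × F → ℝ≥0∞} (hf : Measurable f)
    (hq : Measurable q) (hL : Measurable L) [SFinite (lam.withDensity f)]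
    [SFinite (lam.withDensity q)] {T : E → F} (hT : Measurable T)
    (h : ∀ u y, f (-T u + y) = q y * L (u, y)) :
    (ν.prod (lam.withDensity f)).map (fun p => (p.1, T p.1 + p.2))
      = (ν.prod (lam.withDensity q)).withDensity L := by
  refine Measure.ext_of_lintegral _ fun φ hφ => ?_
  rw [lintegral_map hφ (by fun_prop), lintegral_withDensity_eq_lintegral_mul _ hL hφ,
    lintegral_prod _ (by fun_prop), lintegral_prod _ (by fun_prop)]
  refine lintegral_congr fun u => ?_
  rw [lintegral_withDensity_eq_lintegral_mul _ hf (by fun_prop),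
    lintegral_withDensity_eq_lintegral_mul _ hq (by fun_prop)]
  -- Translation invariance moves the shift by `T u` from the test function to the noise density.
  rw [← lintegral_add_left_eq_self _ (-T u)]
  refine lintegral_congr fun y => ?_
  simp only [Pi.mul_apply, h, add_neg_cancel_left, mul_assoc]

/-! ### Complex Gaussian law: density and polar coordinates -/

/-- The density of the circularly symmetric complex Gaussian law. -/
noncomputable def complexGaussianPDF (v : ℝ) (z : ℂ) : ℝ :=
  Real.exp (-‖z‖ ^ 2 / v) / (Real.pi * v)

lemma measurable_complexGaussianPDF (v : ℝ) : Measurable (complexGaussianPDF v) := by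
  unfold complexGaussianPDF; fun_prop

lemma complexGaussianPDF_nonneg {v : ℝ} (hv : 0 ≤ v) (z : ℂ) : 0 ≤ complexGaussianPDF v z := by
  unfold complexGaussianPDF; positivity

lemma measurable_complex_mk : Measurable fun p : ℝ × ℝ => (⟨p.1, p.2⟩ : ℂ) :=
  Complex.measurableEquivRealProd.symm.measurable

instance (v : ℝ≥0) : IsProbabilityMeasure (complexGaussian v) :=
  Measure.isProbabilityMeasure_map measurable_complex_mk.aemeasurable

lemma complexGaussian_eq_withDensity {v : ℝ≥0} (hv : v ≠ 0) :
    complexGaussian v = volume.withDensity fun z => ENNReal.ofReal (complexGaussianPDF v z) := by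
  have hv2 : v / 2 ≠ 0 := by positivity
  have hvr : (0 : ℝ) < v := by positivity
  refine Measure.ext_of_lintegral _ fun φ hφ => ?_
  have hm := (measurable_complexGaussianPDF v).ennreal_ofReal
  rw [complexGaussian, lintegral_map hφ measurable_complex_mk, gaussianReal_of_var_ne_zero _ hv2,
    prod_withDensity (by fun_prop) (by fun_prop),
    lintegral_withDensity_eq_lintegral_mul _ (by fun_prop)
      (g := fun p : ℝ × ℝ => φ ⟨p.1, p.2⟩) (hφ.comp measurable_complex_mk),
    lintegral_withDensity_eq_lintegral_mul _ hm hφ,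
    ← Complex.volume_preserving_equiv_real_prod.symm.lintegral_comp (hm.mul hφ)]
  refine lintegral_congr fun p => ?_
  simp only [Pi.mul_apply, gaussianPDF, Complex.measurableEquivRealProd_symm_apply]
  congr 1
  rw [← ENNReal.ofReal_mul (gaussianPDFReal_nonneg _ _ _)]
  congr 1
  have hn : ‖(⟨p.1, p.2⟩ : ℂ)‖ ^ 2 = p.1 ^ 2 + p.2 ^ 2 := by
    rw [Complex.sq_norm, Complex.normSq_mk]; ring
  simp only [gaussianPDFReal, complexGaussianPDF, hn]
  have hs : 2 * Real.pi * ((v / 2 : ℝ≥0) : ℝ) = Real.pi * v := by push_cast; ring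
  rw [hs, mul_mul_mul_comm, ← Real.exp_add, ← mul_inv, Real.mul_self_sqrt (by positivity), mul_comm,
    div_eq_mul_inv]
  congr 2
  push_cast
  field_simp
  ring

lemma lintegral_complexGaussianPDF {v : ℝ≥0} (hv : v ≠ 0) :
    ∫⁻ z, ENNReal.ofReal (complexGaussianPDF v z) = 1 := by
  have h : complexGaussian v Set.univ = 1 := measure_univ
  rwa [complexGaussian_eq_withDensity hv, withDensity_apply _ MeasurableSet.univ,
    Measure.restrict_univ] at h

lemma ae_ne_zero_complexGaussian {v : ℝ≥0} (hv : v ≠ 0) : ∀ᵐ z ∂complexGaussian v, z ≠ 0 := by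
  rw [complexGaussian_eq_withDensity hv]
  exact (withDensity_absolutelyContinuous _ _).ae_le
    (Measure.ae_ne volume (0 : ℂ))

/-- Integration in polar coordinates, with the squared modulus as the radial coordinate. -/
lemma lintegral_complex_eq_polar_sq {f : ℂ → ℝ≥0∞} (hf : Measurable f) :
    ∫⁻ z, f z = ∫⁻ s in Set.Ioi (0 : ℝ), ∫⁻ θ in Set.Ioo (-Real.pi) Real.pi,
      ENNReal.ofReal (1 / 2)
        * f (Real.sqrt s * (Real.cos θ + Real.sin θ * Complex.I)) := by
  rw [← Complex.lintegral_comp_polarCoord_symm]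
  have hm : Measurable fun p : ℝ × ℝ =>
      f ((p.1 : ℂ) * (Real.cos p.2 + Real.sin p.2 * Complex.I)) := by fun_prop
  have hm' : Measurable fun p : ℝ × ℝ =>
      f ((Real.sqrt p.1 : ℂ) * (Real.cos p.2 + Real.sin p.2 * Complex.I)) := by fun_prop
  have himg : (fun r : ℝ => r ^ 2) '' Set.Ioi 0 = Set.Ioi 0 := by
    ext x
    refine ⟨?_, fun hx => ⟨Real.sqrt x, Real.sqrt_pos.2 hx, Real.sq_sqrt (le_of_lt hx)⟩⟩
    rintro ⟨r, hr, rfl⟩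
    exact pow_pos (Set.mem_Ioi.1 hr) 2
  conv_rhs => rw [← himg]
  -- Substituting `s = r²` has Jacobian `2r`; with the factor `1/2` it leaves the polar weight `r`.
  rw [lintegral_image_eq_lintegral_abs_deriv_mul measurableSet_Ioi (f' := fun r => 2 * r)
    (fun r _ => by simpa using (hasDerivAt_pow 2 r).hasDerivWithinAt)
    (fun a ha b hb h => (pow_left_inj₀ (le_of_lt ha) (le_of_lt hb) two_ne_zero).1 h)]
  have htar : polarCoord.target = Set.Ioi (0 : ℝ) ×ˢ Set.Ioo (-Real.pi) Real.pi := rfl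
  rw [htar, Measure.volume_eq_prod, ← Measure.prod_restrict, lintegral_prod _ (by
    simp only [smul_eq_mul, Complex.polarCoord_symm_apply]; fun_prop)]
  refine setLIntegral_congr_fun measurableSet_Ioi fun r hr => ?_
  have hr0 : (0 : ℝ) < r := hr
  simp only [smul_eq_mul, Complex.polarCoord_symm_apply, Real.sqrt_sq hr0.le]
  rw [lintegral_const_mul _ (by fun_prop), lintegral_const_mul _ (by fun_prop), ← mul_assoc,
    ← ENNReal.ofReal_mul (abs_nonneg _), abs_of_pos (by positivity)]
  congr 2
  ring

/-- The squared modulus of a standard complex Gaussian is exponentially distributed. -/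
lemma map_norm_sq_complexGaussian :
    (complexGaussian 1).map (fun z => ‖z‖ ^ 2)
      = (volume.restrict (Set.Ioi (0 : ℝ))).withDensity
          fun t => ENNReal.ofReal (Real.exp (-t)) := by
  have hm := (measurable_complexGaussianPDF 1).ennreal_ofReal
  refine Measure.ext_of_lintegral _ fun φ hφ => ?_
  rw [lintegral_map hφ (by fun_prop), complexGaussian_eq_withDensity one_ne_zero,
    lintegral_withDensity_eq_lintegral_mul _ (by simpa using hm) (by fun_prop),
    lintegral_withDensity_eq_lintegral_mul _ (by fun_prop) hφ]
  rw [lintegral_complex_eq_polar_sq (by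
    refine Measurable.mul (by simpa using hm) (by fun_prop))]
  refine setLIntegral_congr_fun measurableSet_Ioi fun s hs => ?_
  have hs0 : (0 : ℝ) < s := hs
  have hn : ∀ θ : ℝ, ‖(Real.sqrt s : ℂ) * (Real.cos θ + Real.sin θ * Complex.I)‖ ^ 2 = s := by
    intro θ
    have h1 : (Real.cos θ + Real.sin θ * Complex.I : ℂ) = Complex.exp (θ * Complex.I) := by
      rw [Complex.exp_mul_I]; push_cast; rfl
    rw [h1, norm_mul, Complex.norm_exp_ofReal_mul_I, mul_one, Complex.norm_real, Real.norm_eq_abs,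
      sq_abs, Real.sq_sqrt hs0.le]
  simp only [Pi.mul_apply, complexGaussianPDF, hn, NNReal.coe_one, div_one, mul_one]
  rw [setLIntegral_const, Real.volume_Ioo, ← mul_assoc, mul_right_comm,
    ← ENNReal.ofReal_mul (by norm_num), ← ENNReal.ofReal_mul (by positivity)]
  congr 2
  field_simp
  ring

lemma integral_norm_sq_complexGaussian {g : ℝ → ℝ} (hg : Measurable g) :
    ∫ z, g (‖z‖ ^ 2) ∂complexGaussian 1 = ∫ t in Set.Ioi (0 : ℝ), Real.exp (-t) * g t := by
  rw [← integral_map (f := g) (φ := fun z : ℂ => ‖z‖ ^ 2) (by fun_prop)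
    hg.aestronglyMeasurable, map_norm_sq_complexGaussian,
    integral_withDensity_eq_integral_toReal_smul (by fun_prop) (by simp)]
  simp [ENNReal.toReal_ofReal, (Real.exp_pos _).le]

lemma integrable_norm_sq_complexGaussian {g : ℝ → ℝ}
    (hi : IntegrableOn (fun t => Real.exp (-t) * g t) (Set.Ioi 0)) :
    Integrable (fun z => g (‖z‖ ^ 2)) (complexGaussian 1) := by
  have h : Integrable g ((complexGaussian 1).map fun z : ℂ => ‖z‖ ^ 2) := by
    rw [map_norm_sq_complexGaussian,
      integrable_withDensity_iff_integrable_smul' (by fun_prop) (by simp)]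
    simpa [ENNReal.toReal_ofReal, (Real.exp_pos _).le, IntegrableOn] using hi
  exact h.comp_measurable (by fun_prop)

/-! ### Exponential integrals, `Ei` and Euler's constant -/

lemma integrableOn_exp_neg : IntegrableOn (fun t : ℝ => Real.exp (-t)) (Set.Ioi 0) := by
  have h := Real.GammaIntegral_convergent one_pos
  simpa using h

lemma integrableOn_exp_neg_mul_id : IntegrableOn (fun t : ℝ => Real.exp (-t) * t) (Set.Ioi 0) := by
  have h := Real.GammaIntegral_convergent two_pos
  refine h.congr_fun (fun t _ => ?_) measurableSet_Ioi
  norm_num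

/-- The singularity at `0` is handled by applying `log x ≤ x` to `x = t^(-1/2)`, a power that stays
integrable against `e^{-t}` through `Γ(1/2)`. -/
lemma abs_log_le_rpow_add {t : ℝ} (ht : 0 < t) :
    |Real.log t| ≤ 2 * t ^ ((1 / 2 : ℝ) - 1) + t := by
  have hp : 0 < t ^ ((1 / 2 : ℝ) - 1) := Real.rpow_pos_of_pos ht _
  rw [abs_le]
  constructor
  · have h := Real.log_le_self hp.le
    rw [Real.log_rpow ht] at h
    linarith
  · linarith [Real.log_le_self ht.le]

lemma integrableOn_exp_neg_mul_log_bound :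
    IntegrableOn (fun t : ℝ => Real.exp (-t) * (2 * t ^ ((1 / 2 : ℝ) - 1) + t)) (Set.Ioi 0) := by
  have h1 := Real.GammaIntegral_convergent (s := 1 / 2) (by norm_num)
  refine (Integrable.add (h1.const_mul 2) integrableOn_exp_neg_mul_id).congr
    (ae_of_all _ fun t => ?_)
  simp only [Pi.add_apply]
  ring

lemma integrableOn_exp_neg_mul_log :
    IntegrableOn (fun t : ℝ => Real.exp (-t) * Real.log t) (Set.Ioi 0) := by
  refine Integrable.mono' integrableOn_exp_neg_mul_log_bound
    (by fun_prop) ?_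
  filter_upwards [ae_restrict_mem measurableSet_Ioi] with t ht
  rw [norm_mul, Real.norm_eq_abs, Real.norm_eq_abs, abs_of_pos (Real.exp_pos _)]
  exact mul_le_mul_of_nonneg_left (abs_log_le_rpow_add ht) (Real.exp_pos _).le

/-- This is `Γ'(1) = -γ`, with the Gamma integral differentiated under the integral sign. -/
lemma integral_exp_neg_mul_log :
    ∫ t in Set.Ioi (0 : ℝ), Real.exp (-t) * Real.log t = -Real.eulerMascheroniConstant := by
  have h1 := Complex.hasDerivAt_GammaIntegral (s := 1) (by simp)
  have h2 : HasDerivAt Complex.GammaIntegral (-Real.eulerMascheroniConstant : ℂ) 1 := by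
    refine Complex.hasDerivAt_Gamma_one.congr_of_eventuallyEq ?_
    have : IsOpen {s : ℂ | 0 < s.re} := Complex.continuous_re.isOpen_preimage _ isOpen_Ioi
    filter_upwards [this.mem_nhds (show (1 : ℂ) ∈ {s : ℂ | 0 < s.re} by simp)] with s hs
    exact (Complex.Gamma_eq_integral hs).symm
  have h3 := h1.unique h2
  have h4 : ∫ t in Set.Ioi (0 : ℝ), (t : ℂ) ^ ((1 : ℂ) - 1) * (Real.log t * Real.exp (-t))
      = ((∫ t in Set.Ioi (0 : ℝ), Real.exp (-t) * Real.log t : ℝ) : ℂ) := by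
    rw [← integral_complex_ofReal]
    refine setIntegral_congr_fun measurableSet_Ioi fun t _ => ?_
    simp [mul_comm]
  rw [h4] at h3
  exact_mod_cast h3

lemma integrableOn_exp_neg_mul_log_one_add {c : ℝ} (hc : 0 < c) :
    IntegrableOn (fun t : ℝ => Real.exp (-t) * Real.log (1 + t / c)) (Set.Ioi 0) := by
  refine Integrable.mono' (integrableOn_exp_neg_mul_id.mul_const c⁻¹) (by fun_prop) ?_
  filter_upwards [ae_restrict_mem measurableSet_Ioi] with t ht
  have ht0 : (0 : ℝ) < t := ht
  have h0 : 0 ≤ Real.log (1 + t / c) := Real.log_nonneg (by linarith [div_pos ht0 hc])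
  have h1 : Real.log (1 + t / c) ≤ t / c := by
    linarith [Real.log_le_sub_one_of_pos (show 0 < 1 + t / c by positivity)]
  rw [norm_mul, Real.norm_eq_abs, Real.norm_eq_abs, abs_of_pos (Real.exp_pos _), abs_of_nonneg h0,
    mul_assoc]
  exact mul_le_mul_of_nonneg_left (by rwa [← div_eq_mul_inv]) (Real.exp_pos _).le

/-- `e^c Ei(c)` as the mean of `log (1 + T / c)` for a standard exponential variable `T`. -/
lemma exp_mul_Ei {c : ℝ} (hc : 0 < c) :
    Real.exp c * Ei c = ∫ t in Set.Ioi (0 : ℝ), Real.exp (-t) * Real.log (1 + t / c) := by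
  have hshift : Real.exp c * Ei c = ∫ t in Set.Ioi (0 : ℝ), Real.exp (-t) / (c + t) := by
    have h := (measurePreserving_add_right volume c).setIntegral_preimage_emb
      (measurableEmbedding_addRight c) (fun t => Real.exp (-t) / t) (Set.Ioi c)
    have hp : (fun x : ℝ => x + c) ⁻¹' Set.Ioi c = Set.Ioi 0 := by ext x; simp
    rw [hp] at h
    rw [Ei, ← h, ← integral_const_mul]
    refine setIntegral_congr_fun measurableSet_Ioi fun t _ => ?_
    rw [← mul_div_assoc, ← Real.exp_add, add_comm t c]
    congr 2
    ring
  have hint : IntegrableOn (fun t : ℝ => Real.exp (-t) / (c + t)) (Set.Ioi 0) := by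
    refine Integrable.mono' (integrableOn_exp_neg.mul_const c⁻¹)
      (Measurable.aestronglyMeasurable (by fun_prop)) ?_
    filter_upwards [ae_restrict_mem measurableSet_Ioi] with t ht
    have ht0 : (0 : ℝ) < t := ht
    rw [Real.norm_eq_abs, abs_of_pos (by positivity), div_eq_mul_inv]
    refine mul_le_mul_of_nonneg_left ?_ (Real.exp_pos _).le
    exact inv_anti₀ hc (by linarith)
  have hu : ∀ t ∈ Set.Ioi (0 : ℝ),
      HasDerivAt (fun t => Real.log (1 + t / c)) (1 / (c + t)) t := by
    intro t ht
    have ht0 : (0 : ℝ) < t := ht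
    have h1 : HasDerivAt (fun t : ℝ => 1 + t / c) (1 / c) t :=
      ((hasDerivAt_id t).div_const c).const_add 1
    have h2 := h1.log (by positivity)
    convert h2 using 1
    field_simp
  have hv : ∀ t ∈ Set.Ioi (0 : ℝ), HasDerivAt (fun t => -Real.exp (-t)) (Real.exp (-t)) t := by
    intro t _
    have h1 : HasDerivAt (fun t => -Real.exp (-t)) (-(Real.exp (-t) * -1)) t :=
      ((hasDerivAt_neg t).exp).neg
    simpa using h1
  have hcont : ContinuousAt (fun t => Real.log (1 + t / c) * -Real.exp (-t)) 0 := by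
    have : (1 : ℝ) + 0 / c ≠ 0 := by simp
    fun_prop (disch := assumption)
  -- Integration by parts against `-e^{-t}`. Both boundary values are `0`: at the origin because
  -- `log 1 = 0`, at infinity because `e^{-t}` beats the bound `t / c` on the logarithm.
  have h := integral_Ioi_mul_deriv_eq_deriv_mul hu hv
    ((integrableOn_exp_neg_mul_log_one_add hc).congr_fun (fun t _ => mul_comm _ _)
      measurableSet_Ioi)
    (hint.neg.congr_fun (fun t _ => by simp [div_eq_mul_inv, mul_comm]) measurableSet_Ioi)
    (a' := 0) (b' := 0) ?_ ?_
  · rw [hshift]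
    simp only [mul_neg, integral_neg, sub_neg_eq_add, sub_self, zero_add] at h
    rw [show (∫ t in Set.Ioi (0 : ℝ), Real.exp (-t) * Real.log (1 + t / c))
      = ∫ t in Set.Ioi (0 : ℝ), Real.log (1 + t / c) * Real.exp (-t) by simp_rw [mul_comm], h]
    refine setIntegral_congr_fun measurableSet_Ioi fun t _ => ?_
    rw [div_eq_mul_inv, one_div, mul_comm]
  · have h2 := hcont.tendsto.mono_left (nhdsWithin_le_nhds (s := Set.Ioi (0 : ℝ)))
    simp only [zero_div, add_zero, Real.log_one, zero_mul] at h2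
    exact h2
  · have h3 : Tendsto (fun t : ℝ => c⁻¹ * (t ^ 1 * Real.exp (-t))) atTop (𝓝 (c⁻¹ * 0)) :=
      (Real.tendsto_pow_mul_exp_neg_atTop_nhds_zero 1).const_mul _
    rw [mul_zero] at h3
    refine squeeze_zero_norm' ?_ h3
    filter_upwards [eventually_gt_atTop 0] with t ht0
    have h0 : 0 ≤ Real.log (1 + t / c) := Real.log_nonneg (by linarith [div_pos ht0 hc])
    have h1 : Real.log (1 + t / c) ≤ t / c := by
      linarith [Real.log_le_sub_one_of_pos (show 0 < 1 + t / c by positivity)]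
    simp only [Pi.mul_apply, norm_mul, norm_neg, Real.norm_eq_abs, abs_of_nonneg h0, Real.abs_exp,
      pow_one]
    calc Real.log (1 + t / c) * Real.exp (-t) ≤ t / c * Real.exp (-t) :=
          mul_le_mul_of_nonneg_right h1 (Real.exp_pos _).le
      _ = _ := by ring

/-- Adding `log c` to the integral formula for `e^c Ei(c)` gives `∫ e^{-t} log (c + t)`, which
converges by domination to `∫ e^{-t} log t`. -/
lemma tendsto_exp_mul_Ei_add_log :
    Tendsto (fun c => Real.exp c * Ei c + Real.log c) (𝓝[>] 0)
      (𝓝 (-Real.eulerMascheroniConstant)) := by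
  rw [← integral_exp_neg_mul_log]
  have key : Tendsto (fun c => ∫ t in Set.Ioi (0 : ℝ), Real.exp (-t) * Real.log (c + t)) (𝓝[>] 0)
      (𝓝 (∫ t in Set.Ioi (0 : ℝ), Real.exp (-t) * Real.log t)) := by
    refine tendsto_integral_filter_of_dominated_convergence
      (fun t => Real.exp (-t) * (2 * t ^ ((1 / 2 : ℝ) - 1) + t) + Real.exp (-t)) ?_ ?_
      (integrableOn_exp_neg_mul_log_bound.add integrableOn_exp_neg) ?_
    · exact Eventually.of_forall fun c => by fun_prop
    -- For `0 < c < 1` the value `log (c + t)` lies between `log t` and `1 + t`, hence the extra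
    -- `e^{-t}` in the dominating function.
    · filter_upwards [Ioo_mem_nhdsGT (zero_lt_one' ℝ)] with c hc
      filter_upwards [ae_restrict_mem measurableSet_Ioi] with t ht
      have ht0 : (0 : ℝ) < t := ht
      rw [norm_mul, Real.norm_eq_abs, Real.norm_eq_abs, Real.abs_exp, ← mul_add_one]
      refine mul_le_mul_of_nonneg_left ?_ (Real.exp_pos _).le
      have h1 := abs_log_le_rpow_add ht0
      have hp : 0 < t ^ ((1 / 2 : ℝ) - 1) := Real.rpow_pos_of_pos ht0 _
      have h2 : Real.log t ≤ Real.log (c + t) := Real.log_le_log ht0 (by linarith [hc.1])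
      have h3 : Real.log (c + t) ≤ c + t := Real.log_le_self (by linarith [hc.1])
      rw [abs_le] at h1 ⊢
      constructor <;> linarith [hc.2]
    · filter_upwards [ae_restrict_mem measurableSet_Ioi] with t ht
      have ht0 : (t : ℝ) ≠ 0 := ne_of_gt ht
      have hcont : ContinuousAt (fun c => Real.exp (-t) * Real.log (c + t)) 0 := by
        have : (0 : ℝ) + t ≠ 0 := by simpa
        fun_prop (disch := assumption)
      have h2 := hcont.tendsto.mono_left (nhdsWithin_le_nhds (s := Set.Ioi (0 : ℝ)))
      simpa using h2
  refine key.congr' ?_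
  filter_upwards [self_mem_nhdsWithin] with c hc
  have hc0 : (0 : ℝ) < c := hc
  have h1 : Real.log c = ∫ t in Set.Ioi (0 : ℝ), Real.exp (-t) * Real.log c := by
    rw [integral_mul_const, integral_exp_neg_Ioi_zero, one_mul]
  rw [exp_mul_Ei hc0]
  conv_rhs => rw [h1]
  rw [← integral_add (integrableOn_exp_neg_mul_log_one_add hc0)
    (integrableOn_exp_neg.mul_const _)]
  refine setIntegral_congr_fun measurableSet_Ioi fun t ht => ?_
  have ht0 : (0 : ℝ) < t := ht
  rw [← mul_add, ← Real.log_mul (by positivity) hc0.ne']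
  congr 2
  field_simp

/-! ### Moments of the Gaussian laws -/

lemma integrable_pow_gaussianReal (v : ℝ≥0) (n : ℕ) :
    Integrable (fun x : ℝ => x ^ n) (gaussianReal 0 v) := by
  have h := (memLp_id_gaussianReal (μ := 0) (v := v) n).integrable_norm_pow'
  refine (integrable_norm_iff (by fun_prop)).1 ?_
  simpa using h

lemma integral_sq_gaussianReal (v : ℝ≥0) : ∫ x, x ^ 2 ∂gaussianReal 0 v = v := by
  have h := variance_fun_id_gaussianReal (μ := 0) (v := v)
  rwa [variance_of_integral_eq_zero (by fun_prop) (by simp)] at h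

lemma integrable_complexGaussian_iff {v : ℝ≥0} {f : ℂ → ℝ} (hf : Measurable f) :
    Integrable f (complexGaussian v) ↔ Integrable (fun p : ℝ × ℝ => f ⟨p.1, p.2⟩)
      ((gaussianReal 0 (v / 2)).prod (gaussianReal 0 (v / 2))) := by
  rw [complexGaussian, integrable_map_measure hf.aestronglyMeasurable
    measurable_complex_mk.aemeasurable]
  rfl

lemma integral_complexGaussian {v : ℝ≥0} {f : ℂ → ℝ} (hf : Measurable f) :
    ∫ z, f z ∂complexGaussian v = ∫ p : ℝ × ℝ, f ⟨p.1, p.2⟩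
      ∂((gaussianReal 0 (v / 2)).prod (gaussianReal 0 (v / 2))) := by
  rw [complexGaussian, integral_map measurable_complex_mk.aemeasurable hf.aestronglyMeasurable]

lemma norm_sq_mk (a b : ℝ) : ‖(⟨a, b⟩ : ℂ)‖ ^ 2 = a ^ 2 + b ^ 2 := by
  rw [Complex.sq_norm, Complex.normSq_mk]; ring

lemma integrable_norm_pow_four_complexGaussian (v : ℝ≥0) :
    Integrable (fun z => ‖z‖ ^ 4) (complexGaussian v) := by
  rw [integrable_complexGaussian_iff (by fun_prop)]
  have h1 := (integrable_pow_gaussianReal (v / 2) 4).comp_fst (gaussianReal 0 (v / 2))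
  have h2 := (integrable_pow_gaussianReal (v / 2) 4).comp_snd (gaussianReal 0 (v / 2))
  refine ((h1.add h2).const_mul 2).mono' (by
    exact (Measurable.aestronglyMeasurable
      ((measurable_norm.comp measurable_complex_mk).pow_const 4))) (ae_of_all _ fun p => ?_)
  have h : ‖(⟨p.1, p.2⟩ : ℂ)‖ ^ 4 = (p.1 ^ 2 + p.2 ^ 2) ^ 2 := by
    rw [← norm_sq_mk]; ring
  rw [norm_pow, norm_norm, h]
  simp only [Pi.add_apply]
  nlinarith [sq_nonneg (p.1 ^ 2 - p.2 ^ 2)]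

lemma integrable_norm_sq_complexGaussian' (v : ℝ≥0) :
    Integrable (fun z => ‖z‖ ^ 2) (complexGaussian v) := by
  refine ((integrable_norm_pow_four_complexGaussian v).add (integrable_const 1)).mono'
    (by fun_prop) (ae_of_all _ fun z => ?_)
  rw [norm_pow, norm_norm]
  simp only [Pi.add_apply]
  nlinarith [sq_nonneg (‖z‖ ^ 2 - 1), sq_nonneg (‖z‖ ^ 2)]

/-- The second moment of a real linear functional of a complex Gaussian. -/
lemma integral_linear_sq_complexGaussian (v : ℝ≥0) (a b : ℝ) :
    ∫ z, (a * z.re + b * z.im) ^ 2 ∂complexGaussian v = (a ^ 2 + b ^ 2) * v / 2 := by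
  rw [integral_complexGaussian (by fun_prop)]
  have h1 := (integrable_pow_gaussianReal (v / 2) 2).comp_fst (gaussianReal 0 (v / 2))
  have h2 := (integrable_pow_gaussianReal (v / 2) 2).comp_snd (gaussianReal 0 (v / 2))
  have h3 := (integrable_pow_gaussianReal (v / 2) 1).mul_prod (integrable_pow_gaussianReal (v / 2) 1)
  have e : (fun p : ℝ × ℝ => (a * p.1 + b * p.2) ^ 2) = fun p =>
      (a ^ 2 * p.1 ^ 2 + b ^ 2 * p.2 ^ 2) + 2 * a * b * (p.1 ^ 1 * p.2 ^ 1) := by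
    funext p; ring
  simp only [e]
  have h12 : Integrable (fun p : ℝ × ℝ => a ^ 2 * p.1 ^ 2 + b ^ 2 * p.2 ^ 2)
      ((gaussianReal 0 (v / 2)).prod (gaussianReal 0 (v / 2))) :=
    (h1.const_mul _).add (h2.const_mul _)
  rw [integral_add h12 (h3.const_mul _), integral_add (h1.const_mul _) (h2.const_mul _),
    integral_const_mul, integral_const_mul,
    integral_const_mul, integral_prod_mul (fun x : ℝ => x ^ 1) (fun x : ℝ => x ^ 1),
    integral_fun_fst (fun x : ℝ => x ^ 2), integral_fun_snd (fun x : ℝ => x ^ 2),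
    integral_sq_gaussianReal]
  simp
  ring

lemma integral_norm_sq_eq_complexGaussian (v : ℝ≥0) : ∫ z, ‖z‖ ^ 2 ∂complexGaussian v = v := by
  have h1 := integral_linear_sq_complexGaussian v 1 0
  have h2 := integral_linear_sq_complexGaussian v 0 1
  have hi := integrable_norm_sq_complexGaussian' v
  have hre : Integrable (fun z : ℂ => (1 * z.re + 0 * z.im) ^ 2) (complexGaussian v) := by
    refine hi.mono' (by fun_prop) (ae_of_all _ fun z => ?_)
    rw [Real.norm_eq_abs, abs_of_nonneg (sq_nonneg _), Complex.sq_norm, Complex.normSq_apply]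
    nlinarith [sq_nonneg z.im]
  have him : Integrable (fun z : ℂ => (0 * z.re + 1 * z.im) ^ 2) (complexGaussian v) := by
    refine hi.mono' (by fun_prop) (ae_of_all _ fun z => ?_)
    rw [Real.norm_eq_abs, abs_of_nonneg (sq_nonneg _), Complex.sq_norm, Complex.normSq_apply]
    nlinarith [sq_nonneg z.re]
  have e : (fun z : ℂ => ‖z‖ ^ 2) = fun z =>
      (1 * z.re + 0 * z.im) ^ 2 + (0 * z.re + 1 * z.im) ^ 2 := by
    funext z
    rw [Complex.sq_norm, Complex.normSq_apply]; ring
  rw [e, integral_add hre him, h1, h2]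
  ring

/-! ### Expectations under the law of the sources -/

/-- The joint law of the normalized input, the complex noise and the real noise. -/
noncomputable def sourceLaw (s t : ℝ≥0) : Measure (ℂ × ℂ × ℝ) :=
  (complexGaussian 1).prod ((complexGaussian s).prod (gaussianReal 0 t))

instance (s t : ℝ≥0) : IsProbabilityMeasure (sourceLaw s t) := by
  unfold sourceLaw; infer_instance

section SourceLaw

variable {s t : ℝ≥0} {f : ℂ → ℝ} {g : ℝ → ℝ}

lemma integrable_input (hf : Integrable f (complexGaussian 1)) :
    Integrable (fun w : ℂ × ℂ × ℝ => f w.1) (sourceLaw s t) := hf.comp_fst _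

lemma integrable_complex_noise (hf : Integrable f (complexGaussian s)) :
    Integrable (fun w : ℂ × ℂ × ℝ => f w.2.1) (sourceLaw s t) :=
  (hf.comp_fst (gaussianReal 0 t)).comp_snd _

lemma integrable_real_noise (hg : Integrable g (gaussianReal 0 t)) :
    Integrable (fun w : ℂ × ℂ × ℝ => g w.2.2) (sourceLaw s t) :=
  (hg.comp_snd (complexGaussian s)).comp_snd _

lemma integral_input (f : ℂ → ℝ) :
    ∫ w, f w.1 ∂sourceLaw s t = ∫ x, f x ∂complexGaussian 1 := by
  rw [sourceLaw, integral_fun_fst (fun x => f x)]; simp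

lemma integral_complex_noise (f : ℂ → ℝ) :
    ∫ w, f w.2.1 ∂sourceLaw s t = ∫ x, f x ∂complexGaussian s := by
  rw [sourceLaw, integral_fun_snd (fun x : ℂ × ℝ => f x.1), integral_fun_fst (fun x => f x)]; simp

lemma integral_real_noise (g : ℝ → ℝ) :
    ∫ w, g w.2.2 ∂sourceLaw s t = ∫ x, g x ∂gaussianReal 0 t := by
  rw [sourceLaw, integral_fun_snd (fun x : ℂ × ℝ => g x.2), integral_fun_snd (fun x => g x)]; simp

lemma ae_input_ne_zero : ∀ᵐ w ∂sourceLaw s t, w.1 ≠ 0 :=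
  Measure.quasiMeasurePreserving_fst.ae (ae_ne_zero_complexGaussian one_ne_zero)

variable (s t)

lemma integrable_input_norm_sq :
    Integrable (fun w : ℂ × ℂ × ℝ => ‖w.1‖ ^ 2) (sourceLaw s t) :=
  integrable_input (integrable_norm_sq_complexGaussian' 1)

lemma integrable_complex_noise_norm_sq :
    Integrable (fun w : ℂ × ℂ × ℝ => ‖w.2.1‖ ^ 2) (sourceLaw s t) :=
  integrable_complex_noise (integrable_norm_sq_complexGaussian' s)

lemma integrable_complex_noise_norm_pow_four :
    Integrable (fun w : ℂ × ℂ × ℝ => ‖w.2.1‖ ^ 4) (sourceLaw s t) :=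
  integrable_complex_noise (integrable_norm_pow_four_complexGaussian s)

lemma integrable_real_noise_sq :
    Integrable (fun w : ℂ × ℂ × ℝ => w.2.2 ^ 2) (sourceLaw s t) :=
  integrable_real_noise (integrable_pow_gaussianReal t 2)

lemma integral_input_norm_sq : ∫ w, ‖w.1‖ ^ 2 ∂sourceLaw s t = 1 := by
  rw [integral_input fun x => ‖x‖ ^ 2, integral_norm_sq_eq_complexGaussian]; simp

lemma integral_complex_noise_norm_sq : ∫ w, ‖w.2.1‖ ^ 2 ∂sourceLaw s t = s := by
  rw [integral_complex_noise fun x => ‖x‖ ^ 2, integral_norm_sq_eq_complexGaussian]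

lemma integral_real_noise_sq : ∫ w, w.2.2 ^ 2 ∂sourceLaw s t = t := by
  rw [integral_real_noise fun x => x ^ 2, integral_sq_gaussianReal]

/-- The component of the complex noise along a unit direction `(a x, b x) / ‖x‖` depending on the
input `x` is square integrable with second moment `s / 2`. -/
lemma projection_sq_sourceLaw {a b : ℂ → ℝ} (ha : Measurable a) (hb : Measurable b)
    (hab : ∀ x, a x ^ 2 + b x ^ 2 = ‖x‖ ^ 2) :
    Integrable (fun w : ℂ × ℂ × ℝ => (a w.1 * w.2.1.re + b w.1 * w.2.1.im) ^ 2 / ‖w.1‖ ^ 2)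
      (sourceLaw s t) ∧
    ∫ w, (a w.1 * w.2.1.re + b w.1 * w.2.1.im) ^ 2 / ‖w.1‖ ^ 2 ∂sourceLaw s t = s / 2 := by
  have hi : Integrable
      (fun w : ℂ × ℂ × ℝ => (a w.1 * w.2.1.re + b w.1 * w.2.1.im) ^ 2 / ‖w.1‖ ^ 2)
      (sourceLaw s t) := by
    refine (integrable_complex_noise_norm_sq s t).mono'
      (Measurable.aestronglyMeasurable (by fun_prop)) (ae_of_all _ fun w => ?_)
    rw [Real.norm_eq_abs, abs_of_nonneg (by positivity)]
    refine div_le_of_le_mul₀ (by positivity) (by positivity) ?_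
    rw [← hab w.1, Complex.sq_norm, Complex.normSq_apply]
    nlinarith [sq_nonneg (a w.1 * w.2.1.im - b w.1 * w.2.1.re)]
  refine ⟨hi, ?_⟩
  -- With the input frozen, the numerator is the square of a linear functional of the noise with
  -- fixed coefficients, of mean `‖x‖² s / 2`.
  have h : ∀ᵐ x ∂complexGaussian 1, ∫ y : ℂ × ℝ, (a x * y.1.re + b x * y.1.im) ^ 2 / ‖x‖ ^ 2
      ∂((complexGaussian s).prod (gaussianReal 0 t)) = s / 2 := by
    filter_upwards [ae_ne_zero_complexGaussian one_ne_zero] with x hx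
    have hx' : ‖x‖ ^ 2 ≠ 0 := by simpa using hx
    rw [integral_fun_fst (fun z : ℂ => (a x * z.re + b x * z.im) ^ 2 / ‖x‖ ^ 2), integral_div,
      integral_linear_sq_complexGaussian, hab]
    simp
    field_simp
  rw [sourceLaw] at hi ⊢
  rw [integral_prod _ hi, integral_congr_ae h]
  simp

lemma integrable_log_input : Integrable (fun w : ℂ × ℂ × ℝ => Real.log (‖w.1‖ ^ 2))
    (sourceLaw s t) :=
  integrable_input (f := fun x => Real.log (‖x‖ ^ 2))
    (integrable_norm_sq_complexGaussian integrableOn_exp_neg_mul_log)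

lemma integral_log_input :
    ∫ w, Real.log (‖w.1‖ ^ 2) ∂sourceLaw s t = -Real.eulerMascheroniConstant := by
  rw [integral_input fun x => Real.log (‖x‖ ^ 2),
    integral_norm_sq_complexGaussian Real.measurable_log, integral_exp_neg_mul_log]

lemma integrable_log_one_add_input {c : ℝ} (hc : 0 < c) :
    Integrable (fun w : ℂ × ℂ × ℝ => Real.log (1 + ‖w.1‖ ^ 2 / c)) (sourceLaw s t) :=
  integrable_input (f := fun x => Real.log (1 + ‖x‖ ^ 2 / c))
    (integrable_norm_sq_complexGaussian (g := fun r => Real.log (1 + r / c))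
      (integrableOn_exp_neg_mul_log_one_add hc))

lemma integral_log_one_add_input {c : ℝ} (hc : 0 < c) :
    ∫ w, Real.log (1 + ‖w.1‖ ^ 2 / c) ∂sourceLaw s t = Real.exp c * Ei c := by
  rw [integral_input fun x => Real.log (1 + ‖x‖ ^ 2 / c),
    integral_norm_sq_complexGaussian (g := fun r => Real.log (1 + r / c)) (by fun_prop),
    exp_mul_Ei hc]

end SourceLaw

/-! ### The channel law and its density against an auxiliary output law -/

/-- The pair of the input and the output of the splitting channel with gains `α`, `β` as a function
of the sources. -/
noncomputable def channelMap (α β P : ℝ) (w : ℂ × ℂ × ℝ) : ℂ × ℂ × ℝ :=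
  ((Real.sqrt P : ℂ) * w.1, (α : ℂ) * (Real.sqrt P : ℂ) * w.1 + w.2.1, β * P * ‖w.1‖ ^ 2 + w.2.2)

/-- The joint law of the input and the output of the splitting channel. -/
noncomputable def channelLaw (α β P : ℝ) (s t : ℝ≥0) : Measure (ℂ × ℂ × ℝ) :=
  (sourceLaw s t).map (channelMap α β P)

/-- The law of the input of the splitting channel. -/
noncomputable def inputLaw (P : ℝ) : Measure ℂ :=
  (complexGaussian 1).map fun x => (Real.sqrt P : ℂ) * x

@[fun_prop]
lemma measurable_channelMap (α β P : ℝ) : Measurable (channelMap α β P) := by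
  unfold channelMap; fun_prop

instance (α β P : ℝ) (s t : ℝ≥0) : IsProbabilityMeasure (channelLaw α β P s t) :=
  Measure.isProbabilityMeasure_map (by fun_prop)

instance (P : ℝ) : IsProbabilityMeasure (inputLaw P) :=
  Measure.isProbabilityMeasure_map (by fun_prop)

/-- The noiseless output of the splitting channel. -/
noncomputable def noiselessOutput (α β : ℝ) (u : ℂ) : ℂ × ℝ := ((α : ℂ) * u, β * ‖u‖ ^ 2)

lemma measurable_noiselessOutput (α β : ℝ) : Measurable (noiselessOutput α β) := by
  unfold noiselessOutput; fun_prop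

lemma channelLaw_eq_map_prod (α β : ℝ) {P : ℝ} (hP : 0 ≤ P) (s t : ℝ≥0) :
    channelLaw α β P s t =
      ((inputLaw P).prod ((complexGaussian s).prod (gaussianReal 0 t))).map
        (fun p => (p.1, noiselessOutput α β p.1 + p.2)) := by
  have hm := measurable_noiselessOutput α β
  have h := Measure.map_prod_map (complexGaussian 1) ((complexGaussian s).prod (gaussianReal 0 t))
    (f := fun x => (Real.sqrt P : ℂ) * x) (g := id) (by fun_prop) measurable_id
  rw [Measure.map_id] at h
  rw [inputLaw, h, Measure.map_map (by fun_prop) (by fun_prop), channelLaw, sourceLaw]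
  congr 1
  funext w
  simp only [channelMap, noiselessOutput, Function.comp_apply, Prod.map, id]
  refine Prod.ext rfl (Prod.ext ?_ ?_)
  · simp [mul_assoc]
  · simp only [Prod.snd_add, norm_mul, Complex.norm_real, mul_pow, Real.norm_eq_abs, sq_abs,
      Real.sq_sqrt hP, mul_assoc]

/-- The density of the noise. -/
noncomputable def noisePDF (s t : ℝ≥0) (y : ℂ × ℝ) : ℝ≥0∞ :=
  ENNReal.ofReal (complexGaussianPDF s y.1) * gaussianPDF 0 t y.2

@[fun_prop]
lemma measurable_noisePDF (s t : ℝ≥0) : Measurable (noisePDF s t) := by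
  have := measurable_complexGaussianPDF s
  unfold noisePDF; fun_prop

lemma noise_eq_withDensity {s t : ℝ≥0} (hs : s ≠ 0) (ht : t ≠ 0) :
    (complexGaussian s).prod (gaussianReal 0 t)
      = ((volume : Measure ℂ).prod (volume : Measure ℝ)).withDensity (noisePDF s t) := by
  have := measurable_complexGaussianPDF s
  rw [complexGaussian_eq_withDensity hs, gaussianReal_of_var_ne_zero _ ht,
    prod_withDensity (by fun_prop) (by fun_prop)]
  rfl

/-- The density of an auxiliary output law: the first component is complex Gaussian, and the second
component is conditionally Gaussian given the first one. -/
noncomputable def auxPDF (τ : ℝ≥0) (m : ℂ → ℝ) (v : ℂ → ℝ≥0) (y : ℂ × ℝ) : ℝ≥0∞ :=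
  ENNReal.ofReal (complexGaussianPDF τ y.1) * gaussianPDF (m y.1) (v y.1) y.2

lemma measurable_auxPDF (τ : ℝ≥0) {m : ℂ → ℝ} {v : ℂ → ℝ≥0} (hm : Measurable m)
    (hv : Measurable v) : Measurable (auxPDF τ m v) := by
  have h1 := measurable_complexGaussianPDF τ
  have h2 : Measurable fun y : ℂ × ℝ => gaussianPDF (m y.1) (v y.1) y.2 :=
    Measurable.comp (g := fun x : ℝ × ℝ≥0 × ℝ => gaussianPDF x.1 x.2.1 x.2.2)
      (f := fun y : ℂ × ℝ => (m y.1, v y.1, y.2)) measurable_uncurry_gaussianPDF (by fun_prop)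
  unfold auxPDF; fun_prop

lemma isProbabilityMeasure_auxLaw {τ : ℝ≥0} (hτ : τ ≠ 0) {m : ℂ → ℝ} {v : ℂ → ℝ≥0}
    (hm : Measurable m) (hv : Measurable v) (hv0 : ∀ y, v y ≠ 0) :
    IsProbabilityMeasure
      (((volume : Measure ℂ).prod (volume : Measure ℝ)).withDensity (auxPDF τ m v)) := by
  constructor
  rw [withDensity_apply _ MeasurableSet.univ, Measure.restrict_univ,
    lintegral_prod _ (measurable_auxPDF τ hm hv).aemeasurable, ← lintegral_complexGaussianPDF hτ]
  refine lintegral_congr fun y => ?_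
  simp only [auxPDF]
  rw [lintegral_const_mul _ (measurable_gaussianPDF _ _), lintegral_gaussianPDF_eq_one _ (hv0 y),
    mul_one]

/-- The logarithm of the ratio of the transition density to the density of the auxiliary law. -/
noncomputable def logDensityRatio (α β s t τ : ℝ) (m v : ℂ → ℝ) (p : ℂ × ℂ × ℝ) : ℝ :=
  (Real.log (τ / s) + ‖p.2.1‖ ^ 2 / τ - ‖-((α : ℂ) * p.1) + p.2.1‖ ^ 2 / s)
    + (Real.log (v p.2.1 / t) / 2 + (p.2.2 - m p.2.1) ^ 2 / (2 * v p.2.1)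
      - (-(β * ‖p.1‖ ^ 2) + p.2.2) ^ 2 / (2 * t))

/-- The two points are unrelated on purpose: `z` will be the noise and `y` the output. -/
lemma complexGaussianPDF_eq_mul_exp {s τ : ℝ} (hs : 0 < s) (hτ : 0 < τ) (y z : ℂ) :
    complexGaussianPDF s z
      = complexGaussianPDF τ y * Real.exp (Real.log (τ / s) + ‖y‖ ^ 2 / τ - ‖z‖ ^ 2 / s) := by
  rw [sub_eq_add_neg, Real.exp_add, Real.exp_add, Real.exp_log (by positivity)]
  simp only [complexGaussianPDF, neg_div]
  rw [Real.exp_neg (‖y‖ ^ 2 / τ)]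
  have := Real.pi_ne_zero
  field_simp

lemma gaussianPDFReal_eq_mul_exp {t v : ℝ≥0} (ht : 0 < t) (hv : 0 < v) (m y n : ℝ) :
    gaussianPDFReal 0 t n = gaussianPDFReal m v y
      * Real.exp (Real.log (v / t) / 2 + (y - m) ^ 2 / (2 * v) - n ^ 2 / (2 * t)) := by
  have ht' : (0 : ℝ) < t := ht
  have hv' : (0 : ℝ) < v := hv
  have hsq : Real.exp (Real.log (v / t) / 2) = Real.sqrt v / Real.sqrt t := by
    rw [← Real.sqrt_div hv'.le, ← Real.log_sqrt (by positivity), Real.exp_log (by positivity)]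
  rw [sub_eq_add_neg, Real.exp_add, Real.exp_add, hsq]
  simp only [gaussianPDFReal, neg_div, sub_zero]
  rw [Real.exp_neg ((y - m) ^ 2 / (2 * v)), Real.sqrt_mul (by positivity) (v : ℝ),
    Real.sqrt_mul (by positivity) (t : ℝ)]
  have h1 := (Real.sqrt_pos.2 hv').ne'
  have h2 := (Real.sqrt_pos.2 ht').ne'
  field_simp

lemma channelLaw_eq_withDensity (α β : ℝ) {P : ℝ} (hP : 0 ≤ P) {s t τ : ℝ≥0} (hs : 0 < s)
    (ht : 0 < t) (hτ : 0 < τ) {m : ℂ → ℝ} {v : ℂ → ℝ≥0}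
    (hm : Measurable m) (hv : Measurable v) (hv0 : ∀ y, 0 < v y) :
    channelLaw α β P s t =
      ((inputLaw P).prod (((volume : Measure ℂ).prod (volume : Measure ℝ)).withDensity
        (auxPDF τ m v))).withDensity
          fun p => ENNReal.ofReal (Real.exp (logDensityRatio α β s t τ m (fun y => v y) p)) := by
  have hQ := isProbabilityMeasure_auxLaw hτ.ne' hm hv fun y => (hv0 y).ne'
  have hN : SFinite (((volume : Measure ℂ).prod (volume : Measure ℝ)).withDensity
      (noisePDF s t)) := by
    rw [← noise_eq_withDensity hs.ne' ht.ne']; infer_instance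
  rw [channelLaw_eq_map_prod α β hP, noise_eq_withDensity hs.ne' ht.ne']
  refine map_additive_noise_eq_withDensity _ _ (measurable_noisePDF s t)
    (measurable_auxPDF τ hm hv) ?_ (measurable_noiselessOutput α β) fun u y => ?_
  · unfold logDensityRatio; fun_prop
  · simp only [noisePDF, auxPDF, gaussianPDF, noiselessOutput, Prod.fst_add, Prod.snd_add,
      Prod.fst_neg, Prod.snd_neg]
    rw [← ENNReal.ofReal_mul (complexGaussianPDF_nonneg (by positivity) _),
      ← ENNReal.ofReal_mul (complexGaussianPDF_nonneg (by positivity) _), ← ENNReal.ofReal_mul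
        (mul_nonneg (complexGaussianPDF_nonneg (by positivity) _) (gaussianPDFReal_nonneg _ _ _))]
    congr 1
    rw [complexGaussianPDF_eq_mul_exp (s := s) (τ := τ) hs hτ y.1,
      gaussianPDFReal_eq_mul_exp ht (hv0 y.1) (m y.1) y.2, logDensityRatio, Real.exp_add]
    ring

/-! ### Upper bound: the residual vanishes in mean -/

/-- The rescaled conditional variance of the second output given the first output `y`. -/
noncomputable def condVar (k t ε : ℝ) (y : ℂ) : ℝ := t * ε ^ 2 + k * ‖y‖ ^ 2

/-- The rescaled deviation of the second output from its predicted value. -/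
noncomputable def predictionError (α β ε : ℝ) (w : ℂ × ℂ × ℝ) : ℝ :=
  ε * w.2.2 + β / α ^ 2 * (ε * ‖w.2.1‖ ^ 2
    - 2 * ((α * w.1 + ε * w.2.1).re * w.2.1.re + (α * w.1 + ε * w.2.1).im * w.2.1.im))

/-- The part of the log-density ratio which averages out as the power `ε⁻²` tends to infinity. -/
noncomputable def upperResidual (α β s t k ε : ℝ) (w : ℂ × ℂ × ℝ) : ℝ :=
  ‖w.1 + (ε / α : ℝ) * w.2.1‖ ^ 2 - ‖w.2.1‖ ^ 2 / s
    + (Real.log (condVar k t ε (α * w.1 + ε * w.2.1)) - Real.log (condVar k t ε (α * w.1))) / 2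
    + predictionError α β ε w ^ 2 / (2 * condVar k t ε (α * w.1 + ε * w.2.1))
    - w.2.2 ^ 2 / (2 * t)

lemma measurable_upperResidual (α β s t k ε : ℝ) : Measurable (upperResidual α β s t k ε) := by
  unfold upperResidual predictionError condVar; fun_prop

lemma norm_sq_add_le (x y : ℂ) : ‖x + y‖ ^ 2 ≤ 2 * ‖x‖ ^ 2 + 2 * ‖y‖ ^ 2 := by
  have h := norm_add_le x y
  nlinarith [norm_nonneg (x + y), sq_nonneg (‖x‖ - ‖y‖)]

/-- The bound is free of `y` and `ε`, as domination requires. The cross term is absorbed because `t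
ε²` is part of `condVar k t ε y`, so `k ε² ‖z‖²` is at most that variance times `k ‖z‖² / t`. -/
lemma log_condVar_sub_le {k t ε : ℝ} (hk : 0 < k) (ht : 0 < t) (hε : 0 < ε) (y z : ℂ) :
    Real.log (condVar k t ε (y + ε * z)) - Real.log (condVar k t ε y)
      ≤ Real.log 2 + k * ‖z‖ ^ 2 / t := by
  have h1 : 0 < condVar k t ε y := by unfold condVar; positivity
  have h2 : 0 < condVar k t ε (y + ε * z) := by unfold condVar; positivity
  have h3 : condVar k t ε (y + ε * z) ≤ condVar k t ε y * (2 * (1 + k * ‖z‖ ^ 2 / t)) := by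
    have h := norm_sq_add_le y (ε * z)
    rw [norm_mul, Complex.norm_real, mul_pow, Real.norm_eq_abs, sq_abs] at h
    have e : condVar k t ε y * (2 * (1 + k * ‖z‖ ^ 2 / t)) = 2 * t * ε ^ 2 + 2 * k * ‖y‖ ^ 2
        + 2 * k * ε ^ 2 * ‖z‖ ^ 2 + 2 * k ^ 2 * ‖y‖ ^ 2 * ‖z‖ ^ 2 / t := by
      unfold condVar; field_simp; ring
    have h4 : 0 ≤ 2 * k ^ 2 * ‖y‖ ^ 2 * ‖z‖ ^ 2 / t := by positivity
    have h5 : 0 ≤ t * ε ^ 2 := by positivity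
    rw [e]
    unfold condVar
    nlinarith [mul_le_mul_of_nonneg_left h hk.le]
  have h4 := Real.log_le_log h2 h3
  rw [Real.log_mul h1.ne' (by positivity), Real.log_mul two_ne_zero (by positivity)] at h4
  have h5 := Real.log_le_sub_one_of_pos (show 0 < 1 + k * ‖z‖ ^ 2 / t by positivity)
  linarith

lemma abs_log_condVar_sub_le {k t ε : ℝ} (hk : 0 < k) (ht : 0 < t) (hε : 0 < ε) (y z : ℂ) :
    |Real.log (condVar k t ε (y + ε * z)) - Real.log (condVar k t ε y)|
      ≤ Real.log 2 + k * ‖z‖ ^ 2 / t := by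
  have h1 := log_condVar_sub_le hk ht hε y z
  -- The opposite inequality is the same bound started at the shifted point and stepping back.
  have h2 := log_condVar_sub_le hk ht hε (y + ε * z) (-z)
  rw [norm_neg, mul_neg, add_neg_cancel_right] at h2
  rw [abs_le]
  constructor <;> linarith

lemma dot_sq_le (y z : ℂ) : (y.re * z.re + y.im * z.im) ^ 2 ≤ ‖y‖ ^ 2 * ‖z‖ ^ 2 := by
  rw [Complex.sq_norm, Complex.sq_norm, Complex.normSq_apply, Complex.normSq_apply]
  nlinarith [sq_nonneg (y.re * z.im - y.im * z.re)]

/-- Each part of the denominator pays for part of the numerator: `t ε²` for the terms carrying a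
factor `ε`, and `k ‖y‖²` for the inner product of `y` and `z`, via Cauchy–Schwarz. Hence no `ε`
survives. -/
lemma predictionError_sq_le {α β k t ε : ℝ} (hk : 0 < k) (ht : 0 < t) (hε : 0 < ε)
    (w : ℂ × ℂ × ℝ) :
    predictionError α β ε w ^ 2 / (2 * condVar k t ε (α * w.1 + ε * w.2.1))
      ≤ 3 * w.2.2 ^ 2 / (2 * t) + 3 * (β / α ^ 2) ^ 2 * ‖w.2.1‖ ^ 4 / (2 * t)
        + 6 * (β / α ^ 2) ^ 2 * ‖w.2.1‖ ^ 2 / k := by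
  obtain ⟨x, z, n⟩ := w
  unfold predictionError condVar
  simp only
  set y : ℂ := α * x + ε * z
  set b := β / α ^ 2
  have hpos : 0 < t * ε ^ 2 + k * ‖y‖ ^ 2 := by positivity
  rw [div_le_iff₀ (by positivity)]
  have hd := dot_sq_le y z
  set d := y.re * z.re + y.im * z.im
  have h1 : (ε * n + b * (ε * ‖z‖ ^ 2 - 2 * d)) ^ 2
      ≤ 3 * (ε ^ 2 * n ^ 2) + 3 * (b ^ 2 * ε ^ 2 * ‖z‖ ^ 4)
        + 12 * b ^ 2 * (‖y‖ ^ 2 * ‖z‖ ^ 2) := by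
    have h2 : b ^ 2 * d ^ 2 ≤ b ^ 2 * (‖y‖ ^ 2 * ‖z‖ ^ 2) :=
      mul_le_mul_of_nonneg_left hd (sq_nonneg b)
    nlinarith [sq_nonneg (ε * n - b * ε * ‖z‖ ^ 2), sq_nonneg (ε * n + 2 * b * d),
      sq_nonneg (b * ε * ‖z‖ ^ 2 + 2 * b * d)]
  refine h1.trans ?_
  have e : (3 * n ^ 2 / (2 * t) + 3 * b ^ 2 * ‖z‖ ^ 4 / (2 * t) + 6 * b ^ 2 * ‖z‖ ^ 2 / k)
      * (2 * (t * ε ^ 2 + k * ‖y‖ ^ 2))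
      = 3 * (ε ^ 2 * n ^ 2) + 3 * (b ^ 2 * ε ^ 2 * ‖z‖ ^ 4) + 12 * b ^ 2 * (‖y‖ ^ 2 * ‖z‖ ^ 2)
        + (3 * n ^ 2 * k * ‖y‖ ^ 2 / t + 3 * b ^ 2 * ‖z‖ ^ 4 * k * ‖y‖ ^ 2 / t
          + 12 * b ^ 2 * ‖z‖ ^ 2 * t * ε ^ 2 / k) := by
    field_simp; ring
  rw [e]
  refine le_add_of_nonneg_right ?_
  positivity

/-- An upper bound for the absolute value of the residual. -/
noncomputable def upperResidualBound (α β s t k ε : ℝ) (w : ℂ × ℂ × ℝ) : ℝ :=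
  2 * ‖w.1‖ ^ 2 + 2 * (ε / α) ^ 2 * ‖w.2.1‖ ^ 2 + ‖w.2.1‖ ^ 2 / s
    + (Real.log 2 + k * ‖w.2.1‖ ^ 2 / t) / 2
    + (3 * w.2.2 ^ 2 / (2 * t) + 3 * (β / α ^ 2) ^ 2 * ‖w.2.1‖ ^ 4 / (2 * t)
        + 6 * (β / α ^ 2) ^ 2 * ‖w.2.1‖ ^ 2 / k)
    + w.2.2 ^ 2 / (2 * t)

lemma abs_upperResidual_le {α β s t k ε : ℝ} (hs : 0 < s) (ht : 0 < t)
    (hk : 0 < k) (hε : 0 < ε) (w : ℂ × ℂ × ℝ) :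
    |upperResidual α β s t k ε w| ≤ upperResidualBound α β s t k ε w := by
  have h1 := norm_sq_add_le w.1 ((ε / α : ℝ) * w.2.1)
  rw [norm_mul, Complex.norm_real, mul_pow, Real.norm_eq_abs, sq_abs] at h1
  have h2 := abs_log_condVar_sub_le hk ht hε (α * w.1) w.2.1
  have h3 := predictionError_sq_le (α := α) (β := β) hk ht hε w
  have h4 : 0 ≤ ‖w.1 + (ε / α : ℝ) * w.2.1‖ ^ 2 := by positivity
  have h5 : 0 ≤ ‖w.2.1‖ ^ 2 / s := by positivity
  have h6 : 0 ≤ predictionError α β ε w ^ 2 / (2 * condVar k t ε (α * w.1 + ε * w.2.1)) := by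
    unfold condVar; positivity
  have h7 : 0 ≤ w.2.2 ^ 2 / (2 * t) := by positivity
  unfold upperResidual upperResidualBound
  rw [abs_le] at h2 ⊢
  constructor <;> linarith

lemma integrable_upperResidualBound (α β k ε : ℝ) (s t : ℝ≥0) :
    Integrable (upperResidualBound α β s t k ε) (sourceLaw s t) := by
  have hx := integrable_input_norm_sq s t
  have hz := integrable_complex_noise_norm_sq s t
  have hz4 := integrable_complex_noise_norm_pow_four s t
  have hn := integrable_real_noise_sq s t
  unfold upperResidualBound
  have c := integrable_const (μ := sourceLaw s t) (Real.log 2)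
  exact (((((hx.const_mul 2).add (hz.const_mul _)).add (hz.div_const _)).add
    ((c.add ((hz.const_mul k).div_const _)).div_const 2)).add
    ((((hn.const_mul 3).div_const _).add ((hz4.const_mul _).div_const _)).add
      ((hz.const_mul _).div_const _))).add (hn.div_const _)

lemma integrable_upperResidual {α β k ε : ℝ} {s t : ℝ≥0} (hs : 0 < s) (ht : 0 < t)
    (hk : 0 < k) (hε : 0 < ε) : Integrable (upperResidual α β s t k ε) (sourceLaw s t) :=
  (integrable_upperResidualBound α β k ε s t).mono'
    (measurable_upperResidual α β s t k ε).aestronglyMeasurable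
    (ae_of_all _ fun w => abs_upperResidual_le hs ht hk hε w)

lemma upperResidual_zero {α β s t k : ℝ} (hα : 0 < α) (hβ : 0 < β) (hs : 0 < s)
    (hk : k = 2 * β ^ 2 * s / α ^ 4) (w : ℂ × ℂ × ℝ) :
    upperResidual α β s t k 0 w = ‖w.1‖ ^ 2 - ‖w.2.1‖ ^ 2 / s
      + (w.1.re * w.2.1.re + w.1.im * w.2.1.im) ^ 2 / ‖w.1‖ ^ 2 / s - w.2.2 ^ 2 / (2 * t) := by
  unfold upperResidual predictionError condVar
  rcases eq_or_ne w.1 0 with h | h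
  -- At zero input both quotients are divisions by zero, equal to `0`.
  · simp [h]
  have hn : ‖w.1‖ ≠ 0 := by simpa using h
  simp only [Complex.ofReal_zero, zero_mul, add_zero, sub_self, zero_div, zero_add, zero_sub,
    ne_eq, OfNat.ofNat_ne_zero, not_false_eq_true, zero_pow, mul_zero, Complex.re_ofReal_mul,
    Complex.im_ofReal_mul, norm_mul, Complex.norm_real, Real.norm_eq_abs, abs_of_pos hα, hk]
  congr 2
  field_simp

/-- The four terms have means `1`, `-1`, `1/2` and `-1/2`. The third is the noise component along
the input direction, normalised by `s` thanks to the choice of `k`. -/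
lemma integral_upperResidual_zero {α β k : ℝ} {s t : ℝ≥0} (hα : 0 < α) (hβ : 0 < β) (hs : 0 < s)
    (ht : 0 < t) (hk : k = 2 * β ^ 2 * s / α ^ 4) :
    ∫ w, upperResidual α β s t k 0 w ∂sourceLaw s t = 0 := by
  have hs' : (0 : ℝ) < s := hs
  have ht' : (0 : ℝ) < t := ht
  have hx := integrable_input_norm_sq s t
  have hz := integrable_complex_noise_norm_sq s t
  have hn := integrable_real_noise_sq s t
  obtain ⟨hp, hpi⟩ := projection_sq_sourceLaw s t (a := fun x => x.re) (b := fun x => x.im)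
    (by fun_prop) (by fun_prop) (fun x => by rw [Complex.sq_norm, Complex.normSq_apply]; ring)
  simp only [upperResidual_zero hα hβ hs' hk]
  have h1 : Integrable (fun w : ℂ × ℂ × ℝ => ‖w.1‖ ^ 2 - ‖w.2.1‖ ^ 2 / s) (sourceLaw s t) :=
    hx.sub (hz.div_const _)
  have h2 : Integrable (fun w : ℂ × ℂ × ℝ => ‖w.1‖ ^ 2 - ‖w.2.1‖ ^ 2 / s
      + (w.1.re * w.2.1.re + w.1.im * w.2.1.im) ^ 2 / ‖w.1‖ ^ 2 / s) (sourceLaw s t) :=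
    h1.add (hp.div_const _)
  rw [integral_sub h2 (hn.div_const _), integral_add h1 (hp.div_const _),
    integral_sub hx (hz.div_const _), integral_div, integral_div, integral_div, hpi,
    integral_input_norm_sq, integral_complex_noise_norm_sq, integral_real_noise_sq]
  field_simp
  norm_num

lemma tendsto_integral_upperResidual {α β k : ℝ} {s t : ℝ≥0} (hα : 0 < α) (hβ : 0 < β)
    (hs : 0 < s) (ht : 0 < t) (hk : k = 2 * β ^ 2 * s / α ^ 4) :
    Tendsto (fun ε => ∫ w, upperResidual α β s t k ε w ∂sourceLaw s t) (𝓝[>] 0) (𝓝 0) := by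
  have hs' : (0 : ℝ) < s := hs
  have ht' : (0 : ℝ) < t := ht
  have hk0 : 0 < k := by rw [hk]; positivity
  suffices h : Tendsto (fun ε => ∫ w, upperResidual α β s t k ε w ∂sourceLaw s t) (𝓝[>] 0)
      (𝓝 (∫ w, upperResidual α β s t k 0 w ∂sourceLaw s t)) by
    rwa [integral_upperResidual_zero hα hβ hs ht hk] at h
  -- The bound is monotone in `ε > 0`, so its value at `ε = 1` dominates for all `ε` in `(0, 1)`.
  refine tendsto_integral_filter_of_dominated_convergence (upperResidualBound α β s t k 1)
    (Eventually.of_forall fun ε => (measurable_upperResidual α β s t k ε).aestronglyMeasurable) ?_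
    (integrable_upperResidualBound α β k 1 s t) ?_
  · filter_upwards [Ioo_mem_nhdsGT (zero_lt_one' ℝ)] with ε hε
    refine ae_of_all _ fun w => (abs_upperResidual_le hs' ht' hk0 hε.1 w).trans ?_
    have h : (ε / α) ^ 2 ≤ (1 / α) ^ 2 := by
      have : 0 < ε := hε.1
      gcongr
      exact hε.2.le
    unfold upperResidualBound
    gcongr
  · filter_upwards [ae_input_ne_zero] with w hw
    have hn : 0 < ‖w.1‖ := by simpa using hw
    have hc : ContinuousAt (fun ε : ℝ => upperResidual α β s t k ε w) 0 := by
      -- At `ε = 0` the conditional variance is positive only when the input is non-zero, which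
      -- holds almost surely.
      have h1 : (t : ℝ) * 0 ^ 2 + k * ‖(α : ℂ) * w.1 + (0 : ℝ) * w.2.1‖ ^ 2 ≠ 0 := by
        have : 0 < ‖(α : ℂ) * w.1‖ := by
          rw [norm_mul, Complex.norm_real, Real.norm_of_nonneg hα.le]; positivity
        simp only [Complex.ofReal_zero, zero_mul, add_zero]
        positivity
      have h2 : (t : ℝ) * 0 ^ 2 + k * ‖(α : ℂ) * w.1‖ ^ 2 ≠ 0 := by simpa using h1
      have h3 : 2 * ((t : ℝ) * 0 ^ 2 + k * ‖(α : ℂ) * w.1 + (0 : ℝ) * w.2.1‖ ^ 2) ≠ 0 :=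
        mul_ne_zero two_ne_zero h1
      unfold upperResidual predictionError condVar
      fun_prop (disch := assumption)
    exact hc.tendsto.mono_left (nhdsWithin_le_nhds (s := Set.Ioi (0 : ℝ)))

/-- Dividing the first output by `√P` scales its noise to `ε z`, and both the conditional variance
and the squared prediction error acquire a factor `P`, which cancels in their quotient. Replacing
the variance at the noisy point by the one at `α x` isolates the main logarithm. -/
lemma logDensityRatio_channelMap {α β s t k P : ℝ} (hα : 0 < α) (ht : 0 < t) (hk : 0 < k)
    (hP : 0 < P) (w : ℂ × ℂ × ℝ) :
    logDensityRatio α β s t (α ^ 2 * P) (fun y => β / α ^ 2 * ‖y‖ ^ 2)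
        (fun y => t + k * ‖y‖ ^ 2) (channelMap α β P w)
      = Real.log (α ^ 2 * P / s) + Real.log (1 + ‖w.1‖ ^ 2 / (t / (k * α ^ 2 * P))) / 2
        + upperResidual α β s t k (1 / Real.sqrt P) w := by
  obtain ⟨x, z, n⟩ := w
  obtain ⟨r, hr, rfl⟩ : ∃ r : ℝ, 0 < r ∧ P = r ^ 2 :=
    ⟨Real.sqrt P, Real.sqrt_pos.2 hP, (Real.sq_sqrt hP.le).symm⟩
  have hrc : (r : ℂ) ≠ 0 := by exact_mod_cast hr.ne'
  have hαc : (α : ℂ) ≠ 0 := by exact_mod_cast hα.ne'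
  unfold logDensityRatio channelMap upperResidual
  simp only [Real.sqrt_sq hr.le]
  set Y : ℂ := α * r * x + z with hY
  set Y' : ℂ := α * x + ((1 / r : ℝ) : ℂ) * z with hY'
  have hYY : Y = r * Y' := by
    rw [hY, hY']; push_cast; field_simp
  have e2 : ‖Y‖ ^ 2 / (α ^ 2 * r ^ 2) = ‖x + ((1 / r / α : ℝ) : ℂ) * z‖ ^ 2 := by
    have : Y = ((α * r : ℝ) : ℂ) * (x + ((1 / r / α : ℝ) : ℂ) * z) := by
      rw [hY]; push_cast; field_simp
    rw [this, norm_mul, Complex.norm_real, mul_pow, Real.norm_eq_abs, sq_abs]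
    field_simp
  have e3 : -((α : ℂ) * (r * x)) + Y = z := by rw [hY]; ring
  have hv : t + k * ‖Y‖ ^ 2 = r ^ 2 * condVar k t (1 / r) Y' := by
    rw [hYY, norm_mul, Complex.norm_real, mul_pow, Real.norm_eq_abs, sq_abs, condVar]
    field_simp
  have hv' : 1 + ‖x‖ ^ 2 / (t / (k * α ^ 2 * r ^ 2)) = r ^ 2 * condVar k t (1 / r) (α * x) / t := by
    rw [condVar, norm_mul, Complex.norm_real, mul_pow, Real.norm_eq_abs, sq_abs]
    field_simp
  have hc : 0 < condVar k t (1 / r) Y' := by unfold condVar; positivity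
  have hc' : 0 < condVar k t (1 / r) (α * x) := by unfold condVar; positivity
  have e4 : Real.log ((t + k * ‖Y‖ ^ 2) / t) = Real.log (condVar k t (1 / r) Y')
      - Real.log (condVar k t (1 / r) (α * x))
      + Real.log (1 + ‖x‖ ^ 2 / (t / (k * α ^ 2 * r ^ 2))) := by
    rw [hv, hv', Real.log_div (by positivity) ht.ne', Real.log_div (by positivity) ht.ne',
      Real.log_mul (by positivity) hc.ne', Real.log_mul (by positivity) hc'.ne']
    ring
  have e5 : β * r ^ 2 * ‖x‖ ^ 2 + n - β / α ^ 2 * ‖Y‖ ^ 2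
      = r * predictionError α β (1 / r) (x, z, n) := by
    have hYn : ‖Y‖ ^ 2 = r ^ 2 * (Y'.re ^ 2 + Y'.im ^ 2) := by
      rw [hYY, norm_mul, Complex.norm_real, mul_pow, Real.norm_eq_abs, sq_abs, Complex.sq_norm,
        Complex.normSq_apply]
      ring
    have hre : Y'.re = α * x.re + 1 / r * z.re := by
      rw [hY', Complex.add_re, Complex.re_ofReal_mul, Complex.re_ofReal_mul]
    have him : Y'.im = α * x.im + 1 / r * z.im := by
      rw [hY', Complex.add_im, Complex.im_ofReal_mul, Complex.im_ofReal_mul]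
    unfold predictionError
    simp only [← hY']
    rw [hYn, Complex.sq_norm, Complex.sq_norm, Complex.normSq_apply, Complex.normSq_apply, hre, him]
    field_simp
    ring
  have e6 : -(β * ‖(r : ℂ) * x‖ ^ 2) + (β * r ^ 2 * ‖x‖ ^ 2 + n) = n := by
    rw [norm_mul, Complex.norm_real, mul_pow, Real.norm_eq_abs, sq_abs]; ring
  rw [e3, e4, e6, e2, e5, hv]
  field_simp
  ring

/-- Upper bound for the mutual information of the splitting channel. -/
lemma klDiv_channelLaw_le {α β k P : ℝ} {s t : ℝ≥0} (hα : 0 < α) (hβ : 0 < β) (hs : 0 < s)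
    (ht : 0 < t) (hk : k = 2 * β ^ 2 * s / α ^ 4) (hP : 0 < P) :
    klDiv (channelLaw α β P s t) ((inputLaw P).prod (channelLaw α β P s t).snd) ≠ ∞ ∧
    (klDiv (channelLaw α β P s t) ((inputLaw P).prod (channelLaw α β P s t).snd)).toReal
      ≤ Real.log (α ^ 2 * P / s)
        + Real.exp (t / (k * α ^ 2 * P)) * Ei (t / (k * α ^ 2 * P)) / 2
        + ∫ w, upperResidual α β s t k (1 / Real.sqrt P) w ∂sourceLaw s t := by
  have hs' : (0 : ℝ) < s := hs
  have ht' : (0 : ℝ) < t := ht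
  have hk0 : 0 < k := by rw [hk]; positivity
  have hc : 0 < t / (k * α ^ 2 * P) := by positivity
  -- The true first output has variance `α² P + s`; omitting `s` gives the exact leading logarithm
  -- and costs only a vanishing amount.
  obtain ⟨τ, hτ⟩ : ∃ τ : ℝ≥0, (τ : ℝ) = α ^ 2 * P := ⟨⟨α ^ 2 * P, by positivity⟩, rfl⟩
  obtain ⟨κ, hκ⟩ : ∃ κ : ℝ≥0, (κ : ℝ) = k := ⟨⟨k, hk0.le⟩, rfl⟩
  have hτ0 : 0 < τ := by rw [← NNReal.coe_pos, hτ]; positivity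
  have hv : Measurable fun y : ℂ => t + κ * ‖y‖₊ ^ 2 := by fun_prop
  have hv0 : ∀ y : ℂ, 0 < t + κ * ‖y‖₊ ^ 2 := fun y => by positivity
  have hm : Measurable fun y : ℂ => β / α ^ 2 * ‖y‖ ^ 2 := by fun_prop
  have hJ := channelLaw_eq_withDensity α β hP.le hs ht hτ0 hm hv hv0
  have hQ := isProbabilityMeasure_auxLaw hτ0.ne' hm hv fun y => (hv0 y).ne'
  have hl : Measurable (logDensityRatio α β s t τ (fun y => β / α ^ 2 * ‖y‖ ^ 2)
      (fun y => ((t + κ * ‖y‖₊ ^ 2 : ℝ≥0) : ℝ))) := by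
    unfold logDensityRatio; fun_prop
  have hcomp : ∀ w, logDensityRatio α β s t τ (fun y => β / α ^ 2 * ‖y‖ ^ 2)
      (fun y => ((t + κ * ‖y‖₊ ^ 2 : ℝ≥0) : ℝ)) (channelMap α β P w)
      = Real.log (α ^ 2 * P / s) + Real.log (1 + ‖w.1‖ ^ 2 / (t / (k * α ^ 2 * P))) / 2
        + upperResidual α β s t k (1 / Real.sqrt P) w := by
    intro w
    rw [← logDensityRatio_channelMap hα ht' hk0 hP w, hτ, ← hκ]
    push_cast
    rfl
  have hR : Integrable (upperResidual α β s t k (1 / Real.sqrt P)) (sourceLaw s t) :=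
    integrable_upperResidual hs ht hk0 (by positivity)
  have hL := (integrable_log_one_add_input s t hc).div_const 2
  have h1 : Integrable (fun w : ℂ × ℂ × ℝ => Real.log (α ^ 2 * P / s)
      + Real.log (1 + ‖w.1‖ ^ 2 / (t / (k * α ^ 2 * P))) / 2) (sourceLaw s t) :=
    (integrable_const _).add hL
  have hint : Integrable (logDensityRatio α β s t τ (fun y => β / α ^ 2 * ‖y‖ ^ 2)
      (fun y => ((t + κ * ‖y‖₊ ^ 2 : ℝ≥0) : ℝ))) (channelLaw α β P s t) := by
    rw [channelLaw, integrable_map_measure hl.aestronglyMeasurable (by fun_prop)]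
    exact (h1.add hR).congr (ae_of_all _ fun w => (hcomp w).symm)
  obtain ⟨hfin, hle⟩ := klDiv_prod_snd_le_integral _ _ _ hl hJ hint
  refine ⟨hfin, hle.trans (le_of_eq ?_)⟩
  rw [channelLaw, integral_map (by fun_prop) hl.aestronglyMeasurable]
  simp only [hcomp]
  rw [integral_add h1 hR, integral_add (integrable_const _) hL, integral_div,
    integral_log_one_add_input s t hc]
  simp

/-! ### Lower bound: the phase error -/

/-- The argument of `u` relative to the direction of `y`, in `(-π, π]`. -/
noncomputable def phaseGap (u y : ℂ) : ℝ :=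
  Complex.arg (u * Complex.exp (-(Complex.arg y * Complex.I)))

@[fun_prop]
lemma Measurable.phaseGap {E : Type*} [MeasurableSpace E] {f g : E → ℂ} (hf : Measurable f)
    (hg : Measurable g) : Measurable fun x => phaseGap (f x) (g x) := by
  unfold SplittingReceiver.phaseGap
  have h : Measurable fun x => (Complex.arg (g x) : ℂ) :=
    Complex.measurable_ofReal.comp (Complex.measurable_arg.comp hg)
  exact Complex.measurable_arg.comp
    (hf.mul (Complex.measurable_exp.comp (h.mul_const Complex.I).neg))

lemma phaseGap_real_mul_left {r : ℝ} (hr : 0 < r) (u y : ℂ) :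
    phaseGap (r * u) y = phaseGap u y := by
  rw [phaseGap, mul_assoc, Complex.arg_real_mul _ hr, phaseGap]

lemma phaseGap_real_mul_right {r : ℝ} (hr : 0 < r) (u y : ℂ) :
    phaseGap u (r * y) = phaseGap u y := by
  rw [phaseGap, Complex.arg_real_mul _ hr, phaseGap]

lemma abs_phaseGap {u y : ℂ} (hy : y ≠ 0) : |phaseGap u y| = |Complex.arg (y / u)| := by
  have hn : 0 < ‖y‖ := norm_pos_iff.2 hy
  have h : u * Complex.exp (-(Complex.arg y * Complex.I)) = (‖y‖ : ℂ) * (y / u)⁻¹ := by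
    have h1 := Complex.norm_mul_exp_arg_mul_I y
    have h2 : (‖y‖ : ℂ) ≠ 0 := by exact_mod_cast hn.ne'
    rw [inv_div, Complex.exp_neg]
    nth_rewrite 3 [← h1]
    field_simp
  rw [phaseGap, h, Complex.arg_real_mul _ hn, Complex.abs_arg_inv]

lemma abs_arg_one_add_le {w : ℂ} (hw : ‖w‖ ≤ 1 / 2) :
    |Complex.arg (1 + w)| ≤ 2 * Real.pi * ‖w‖ := by
  have h := Complex.norm_log_one_add_half_le_self hw
  have h1 := Complex.abs_im_le_norm (Complex.log (1 + w))
  rw [Complex.log_im] at h1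
  nlinarith [Real.pi_gt_three, norm_nonneg w]

lemma abs_phaseGap_le {α ε : ℝ} (hα : 0 < α) (hε : 0 < ε) {x : ℂ} (hx : x ≠ 0) (z : ℂ) :
    |phaseGap x (α * x + ε * z)| ≤ 2 * Real.pi * (ε * ‖z‖ / (α * ‖x‖)) := by
  have hαc : (α : ℂ) ≠ 0 := by exact_mod_cast hα.ne'
  set w : ℂ := ε * z / (α * x) with hw
  have hwn : ‖w‖ = ε * ‖z‖ / (α * ‖x‖) := by
    rw [hw, norm_div, norm_mul, norm_mul, Complex.norm_real, Complex.norm_real,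
      Real.norm_of_nonneg hα.le, Real.norm_of_nonneg hε.le]
  have hy : α * x + ε * z = α * x * (1 + w) := by rw [hw]; field_simp
  rw [← hwn]
  -- For a small relative perturbation the logarithm estimate applies. Otherwise the trivial bound
  -- `π` is at most `2π‖w‖`, which is where the constant comes from.
  rcases le_total ‖w‖ (1 / 2) with h | h
  · have h0 : 1 + w ≠ 0 := by
      intro h0
      have : ‖w‖ = 1 := by rw [show w = -1 by linear_combination h0]; simp
      linarith
    rw [hy, abs_phaseGap (mul_ne_zero (mul_ne_zero hαc hx) h0),
      show α * x * (1 + w) / x = α * (1 + w) by field_simp, Complex.arg_real_mul _ hα]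
    exact abs_arg_one_add_le h
  · have h1 := Complex.abs_arg_le_pi (x * Complex.exp
      (-(Complex.arg (α * x + ε * z) * Complex.I)))
    rw [phaseGap]
    nlinarith [Real.pi_pos]

/-- The quadratic penalty for the phase error of the first output. -/
noncomputable def phasePenalty (α s ε : ℝ) (w : ℂ × ℂ × ℝ) : ℝ :=
  α ^ 2 * ‖w.1‖ ^ 2 / s * (phaseGap w.1 (α * w.1 + ε * w.2.1) / ε) ^ 2

lemma measurable_phasePenalty (α s ε : ℝ) : Measurable (phasePenalty α s ε) := by
  unfold phasePenalty; fun_prop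

lemma phasePenalty_nonneg {s : ℝ} (hs : 0 < s) (α ε : ℝ) (w : ℂ × ℂ × ℝ) :
    0 ≤ phasePenalty α s ε w := by
  unfold phasePenalty; positivity

/-- The phase error is at most of order `ε ‖z‖ / (α ‖x‖)`; the weight cancels `ε`, `α` and `‖x‖`,
leaving an integrable bound uniform in `ε`. -/
lemma phasePenalty_le {α s ε : ℝ} (hα : 0 < α) (hs : 0 < s) (hε : 0 < ε) (w : ℂ × ℂ × ℝ) :
    phasePenalty α s ε w ≤ (2 * Real.pi) ^ 2 / s * ‖w.2.1‖ ^ 2 := by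
  rcases eq_or_ne w.1 0 with h | h
  · simp only [phasePenalty, h, norm_zero]
    simp only [ne_eq, OfNat.ofNat_ne_zero, not_false_eq_true, zero_pow, mul_zero, zero_div,
      zero_mul]
    positivity
  have hn : 0 < ‖w.1‖ := norm_pos_iff.2 h
  have h1 := abs_phaseGap_le hα hε h w.2.1
  have h2 := pow_le_pow_left₀ (abs_nonneg _) h1 2
  rw [sq_abs] at h2
  calc phasePenalty α s ε w
      = α ^ 2 * ‖w.1‖ ^ 2 / s / ε ^ 2 * phaseGap w.1 (α * w.1 + ε * w.2.1) ^ 2 := by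
        unfold phasePenalty; field_simp
    _ ≤ α ^ 2 * ‖w.1‖ ^ 2 / s / ε ^ 2 * (2 * Real.pi * (ε * ‖w.2.1‖ / (α * ‖w.1‖))) ^ 2 :=
        mul_le_mul_of_nonneg_left h2 (by positivity)
    _ = _ := by field_simp

/-- The argument is the imaginary part of `log`, whose derivative at `1` is `1`. -/
lemma tendsto_arg_one_add_div (q : ℂ) :
    Tendsto (fun ε : ℝ => Complex.arg (1 + ε * q) / ε) (𝓝[>] 0) (𝓝 q.im) := by
  have h1 : HasDerivAt (fun ε : ℝ => 1 + (ε : ℂ) * q) q 0 := by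
    have h := ((Complex.ofRealCLM.hasDerivAt (x := (0 : ℝ))).mul_const q).const_add 1
    simpa using h
  have h2 : HasDerivAt (fun ε : ℝ => Complex.log (1 + (ε : ℂ) * q)) q 0 := by
    simpa using h1.clog_real (by simp)
  have h3 : HasDerivAt (fun ε : ℝ => Complex.arg (1 + (ε : ℂ) * q)) q.im 0 := by
    have h := Complex.imCLM.hasFDerivAt.comp_hasDerivAt (0 : ℝ) h2
    simpa [Function.comp_def, Complex.log_im] using h
  have h4 := hasDerivAt_iff_tendsto_slope_zero.1 h3
  refine (h4.mono_left (nhdsWithin_mono _ fun x hx => ne_of_gt hx)).congr fun ε => ?_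
  simp [div_eq_inv_mul]

lemma tendsto_phasePenalty {α s : ℝ} (hα : 0 < α) {w : ℂ × ℂ × ℝ} (hw : w.1 ≠ 0) :
    Tendsto (fun ε => phasePenalty α s ε w) (𝓝[>] 0)
      (𝓝 ((-w.1.im * w.2.1.re + w.1.re * w.2.1.im) ^ 2 / ‖w.1‖ ^ 2 / s)) := by
  obtain ⟨x, z, n⟩ := w
  simp only at hw ⊢
  have hαc : (α : ℂ) ≠ 0 := by exact_mod_cast hα.ne'
  have hn : ‖x‖ ≠ 0 := norm_ne_zero_iff.2 hw
  have hlim : (-x.im * z.re + x.re * z.im) ^ 2 / ‖x‖ ^ 2 / s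
      = α ^ 2 * ‖x‖ ^ 2 / s * (z / (α * x)).im ^ 2 := by
    have : (z / (α * x)).im = (-x.im * z.re + x.re * z.im) / (α * ‖x‖ ^ 2) := by
      rw [Complex.div_im, Complex.normSq_mul, Complex.normSq_ofReal, Complex.re_ofReal_mul,
        Complex.im_ofReal_mul, ← Complex.sq_norm]
      field_simp
      ring
    rw [this]
    field_simp
  rw [hlim]
  refine (((tendsto_arg_one_add_div (z / (α * x))).pow 2).const_mul _).congr' ?_
  have hne : ∀ᶠ ε : ℝ in 𝓝[>] 0, (α : ℂ) * x + ε * z ≠ 0 := by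
    have hc : ContinuousAt (fun ε : ℝ => (α : ℂ) * x + ε * z) 0 := by fun_prop
    exact (hc.eventually_ne (by simp [hαc, hw])).filter_mono nhdsWithin_le_nhds
  filter_upwards [hne] with ε hε
  have e : ((α : ℂ) * x + ε * z) / x = α * (1 + ε * (z / (α * x))) := by field_simp
  have h1 := abs_phaseGap (u := x) hε
  rw [e, Complex.arg_real_mul _ hα] at h1
  rw [phasePenalty, div_pow, div_pow, ← sq_abs (phaseGap _ _), h1, sq_abs]

lemma integrable_phasePenalty {α ε : ℝ} {s : ℝ≥0} (t : ℝ≥0) (hα : 0 < α) (hs : 0 < s)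
    (hε : 0 < ε) : Integrable (phasePenalty α s ε) (sourceLaw s t) := by
  refine ((integrable_complex_noise_norm_sq s t).const_mul ((2 * Real.pi) ^ 2 / s)).mono'
    (measurable_phasePenalty α s ε).aestronglyMeasurable (ae_of_all _ fun w => ?_)
  rw [Real.norm_of_nonneg (phasePenalty_nonneg (by exact_mod_cast hs) _ _ _)]
  exact phasePenalty_le hα hs hε w

/-- To first order only the noise component orthogonal to the input rotates the phase; its second
moment `s / 2`, divided by `s`, is the limit. -/
lemma tendsto_integral_phasePenalty {α : ℝ} {s : ℝ≥0} (t : ℝ≥0) (hα : 0 < α) (hs : 0 < s) :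
    Tendsto (fun ε => ∫ w, phasePenalty α s ε w ∂sourceLaw s t) (𝓝[>] 0) (𝓝 (1 / 2)) := by
  have hs' : (0 : ℝ) < s := hs
  obtain ⟨hp, hpi⟩ := projection_sq_sourceLaw s t (a := fun x => -x.im) (b := fun x => x.re)
    (by fun_prop) (by fun_prop) (fun x => by rw [Complex.sq_norm, Complex.normSq_apply]; ring)
  have e : (1 / 2 : ℝ) = ∫ w : ℂ × ℂ × ℝ,
      (-w.1.im * w.2.1.re + w.1.re * w.2.1.im) ^ 2 / ‖w.1‖ ^ 2 / s ∂sourceLaw s t := by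
    rw [integral_div, hpi]
    field_simp
  rw [e]
  refine tendsto_integral_filter_of_dominated_convergence
    (fun w => (2 * Real.pi) ^ 2 / s * ‖w.2.1‖ ^ 2)
    (Eventually.of_forall fun ε => (measurable_phasePenalty α s ε).aestronglyMeasurable) ?_
    ((integrable_complex_noise_norm_sq s t).const_mul _) ?_
  · filter_upwards [self_mem_nhdsWithin] with ε hε
    refine ae_of_all _ fun w => ?_
    rw [Real.norm_of_nonneg (phasePenalty_nonneg hs' _ _ _)]
    exact phasePenalty_le hα hs' hε w
  · filter_upwards [ae_input_ne_zero] with w hw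
    exact tendsto_phasePenalty hα hw

/-! ### Lower bound: the auxiliary posterior of the input -/

lemma inputLaw_eq_complexGaussian {P : ℝ≥0} : inputLaw P = complexGaussian P := by
  have hg : (gaussianReal 0 (1 / 2)).map (fun x => Real.sqrt P * x) = gaussianReal 0 (P / 2) := by
    rw [gaussianReal_map_const_mul]
    congr 1
    · simp
    · ext
      simp only [NNReal.coe_mul, NNReal.coe_mk, NNReal.coe_div, NNReal.coe_one, NNReal.coe_ofNat,
        Real.sq_sqrt P.coe_nonneg]
      ring
  rw [inputLaw, complexGaussian, complexGaussian, Measure.map_map (by fun_prop)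
    measurable_complex_mk, ← hg, Measure.map_prod_map _ _ (by fun_prop) (by fun_prop),
    Measure.map_map measurable_complex_mk (by fun_prop)]
  congr 1
  funext p
  apply Complex.ext <;> simp

/-- The logarithm of the ratio of an auxiliary conditional density of the input, given the output,
to the density of the input. -/
noncomputable def logPosteriorRatio (α β s t P : ℝ) (p : ℂ × ℂ × ℝ) : ℝ :=
  Real.log (2 * Real.pi * P * β) - Real.log (2 * Real.pi * t) / 2
    - (β * ‖p.1‖ ^ 2 - p.2.2) ^ 2 / (2 * t)
    + (Real.log (α ^ 2 / (Real.pi * s)) + Real.log (‖p.1‖ ^ 2)) / 2 + ‖p.1‖ ^ 2 / P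
    - α ^ 2 * ‖p.1‖ ^ 2 / s * phaseGap p.1 p.2.1 ^ 2

@[fun_prop]
lemma measurable_logPosteriorRatio (α β s t P : ℝ) : Measurable (logPosteriorRatio α β s t P) := by
  unfold logPosteriorRatio; fun_prop

lemma exp_half_log {x : ℝ} (hx : 0 < x) : Real.exp (Real.log x / 2) = Real.sqrt x := by
  rw [← Real.log_sqrt hx.le, Real.exp_log (Real.sqrt_pos.2 hx)]

/-- In polar coordinates the auxiliary conditional density is a product of Gaussian densities. -/
lemma exp_logPosteriorRatio_polar {α β P : ℝ} {s t : ℝ≥0} (hα : 0 < α) (hβ : 0 < β) (hs : 0 < s)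
    (ht : 0 < t) (hP : 0 < P) {r : ℝ} (hr : 0 < r) {v : ℝ≥0} (hv : (v : ℝ) = s / (2 * α ^ 2 * r))
    {u : ℂ} (hu : ‖u‖ ^ 2 = r) (y : ℂ × ℝ) :
    1 / 2 * (complexGaussianPDF P u * Real.exp (logPosteriorRatio α β s t P (u, y)))
      = β * gaussianPDFReal y.2 t (β * r) * gaussianPDFReal 0 v (phaseGap u y.1) := by
  have hs' : (0 : ℝ) < s := hs
  have ht' : (0 : ℝ) < t := ht
  have hpi := Real.pi_pos
  have e : logPosteriorRatio α β s t P (u, y) = Real.log (2 * Real.pi * P * β)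
      - Real.log (2 * Real.pi * t) / 2 + -((β * r - y.2) ^ 2 / (2 * t))
      + Real.log (α ^ 2 / (Real.pi * s) * r) / 2 + r / P
      + -(α ^ 2 * r / s * phaseGap u y.1 ^ 2) := by
    rw [logPosteriorRatio, Real.log_mul (by positivity) hr.ne']
    simp only [hu]
    ring
  have hv2 : 2 * Real.pi * (s / (2 * α ^ 2 * r)) = (α ^ 2 / (Real.pi * s) * r)⁻¹ := by
    field_simp
  have ev : -(phaseGap u y.1 - 0) ^ 2 / (2 * (s / (2 * α ^ 2 * r)))
      = -(α ^ 2 * r / s * phaseGap u y.1 ^ 2) := by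
    field_simp
    ring
  rw [e, Real.exp_add, Real.exp_add, Real.exp_add, Real.exp_add, Real.exp_sub,
    Real.exp_log (by positivity), exp_half_log (by positivity), exp_half_log (by positivity)]
  simp only [gaussianPDFReal, complexGaussianPDF, hu, hv, hv2, ev, Real.sqrt_inv, inv_inv, neg_div]
  rw [Real.exp_neg (r / P)]
  have h1 : Real.sqrt (2 * Real.pi * t) ≠ 0 := (Real.sqrt_pos.2 (by positivity)).ne'
  field_simp

lemma lintegral_comp_const_mul_gaussianPDF {β : ℝ} (hβ : 0 < β) (m : ℝ) {t : ℝ≥0} (ht : 0 < t) :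
    ∫⁻ r, ENNReal.ofReal (β * gaussianPDFReal m t (β * r)) = 1 := by
  have h : ∀ r, β * gaussianPDFReal m t (β * r)
      = gaussianPDFReal (β⁻¹ * m) (.mk (β ^ 2)⁻¹ (inv_nonneg.mpr (sq_nonneg _)) * t) r := by
    intro r
    rw [gaussianPDFReal_mul hβ.ne', abs_of_pos (by positivity), ← mul_assoc,
      mul_inv_cancel₀ hβ.ne', one_mul]
  simp only [h]
  refine lintegral_gaussianPDFReal_eq_one _ (mul_ne_zero ?_ ht.ne')
  rw [← NNReal.coe_ne_zero, NNReal.coe_mk]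
  positivity

/-- In polar coordinates centred at the direction of `y.1` the integrand is a product of two
Gaussian densities, the angular variance depending on the radius. It is integrated over the angle
first. -/
lemma lintegral_exp_logPosteriorRatio_le {α β P : ℝ} {s t : ℝ≥0} (hα : 0 < α) (hβ : 0 < β)
    (hs : 0 < s) (ht : 0 < t) (hP : 0 < P) (y : ℂ × ℝ) :
    ∫⁻ u, ENNReal.ofReal (Real.exp (logPosteriorRatio α β s t P (u, y))) ∂inputLaw P ≤ 1 := by
  obtain ⟨P', rfl⟩ : ∃ P' : ℝ≥0, (P' : ℝ) = P := ⟨⟨P, hP.le⟩, rfl⟩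
  have hP' : P' ≠ 0 := by rintro rfl; simp at hP
  have hpdf := measurable_complexGaussianPDF P'
  have hm : Measurable fun u => ENNReal.ofReal (complexGaussianPDF P' u)
      * ENNReal.ofReal (Real.exp (logPosteriorRatio α β s t P' (u, y))) := by fun_prop
  rw [inputLaw_eq_complexGaussian, complexGaussian_eq_withDensity hP',
    lintegral_withDensity_eq_lintegral_mul _ (by fun_prop) (by fun_prop)]
  simp only [Pi.mul_apply]
  set a := Complex.arg y.1 with ha
  -- Rotating by the argument of `y.1` makes the polar angle equal to the phase gap.
  have hrot := (rotation (Circle.exp a)).measurePreserving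
  rw [← hrot.lintegral_comp hm, lintegral_complex_eq_polar_sq
    (f := fun z => ENNReal.ofReal (complexGaussianPDF P' (rotation (Circle.exp a) z))
      * ENNReal.ofReal (Real.exp (logPosteriorRatio α β s t P' (rotation (Circle.exp a) z, y))))
    (hm.comp hrot.measurable)]
  calc _ ≤ ∫⁻ r in Set.Ioi (0 : ℝ), ENNReal.ofReal (β * gaussianPDFReal y.2 t (β * r)) := by
        refine setLIntegral_mono (by fun_prop) fun r hr => ?_
        have hr0 : (0 : ℝ) < r := hr
        have hsr : 0 < Real.sqrt r := Real.sqrt_pos.2 hr0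
        obtain ⟨v, hv⟩ : ∃ v : ℝ≥0, (v : ℝ) = s / (2 * α ^ 2 * r) :=
          ⟨⟨s / (2 * α ^ 2 * r), by positivity⟩, rfl⟩
        have hv0 : v ≠ 0 := by
          rw [← NNReal.coe_ne_zero, hv]
          have hs' : (0 : ℝ) < s := hs
          positivity
        calc _ ≤ ∫⁻ θ in Set.Ioo (-Real.pi) Real.pi,
              ENNReal.ofReal (β * gaussianPDFReal y.2 t (β * r)) * gaussianPDF 0 v θ := by
              refine setLIntegral_mono (by fun_prop) fun θ hθ => le_of_eq ?_
              rw [rotation_apply, Circle.coe_exp]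
              set u : ℂ := Complex.exp (a * Complex.I)
                * (Real.sqrt r * (Real.cos θ + Real.sin θ * Complex.I)) with hu
              have hphase : phaseGap u y.1 = θ := by
                rw [phaseGap, ← ha, hu, mul_right_comm, ← Complex.exp_add, add_neg_cancel,
                  Complex.exp_zero, one_mul, Complex.ofReal_cos, Complex.ofReal_sin]
                exact Complex.arg_mul_cos_add_sin_mul_I hsr ⟨hθ.1, hθ.2.le⟩
              have hnorm : ‖u‖ ^ 2 = r := by
                have h1 : (Real.cos θ + Real.sin θ * Complex.I : ℂ)
                    = Complex.exp (θ * Complex.I) := by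
                  rw [Complex.exp_mul_I]; push_cast; rfl
                rw [hu, h1, norm_mul, norm_mul, Complex.norm_exp_ofReal_mul_I,
                  Complex.norm_exp_ofReal_mul_I, Complex.norm_real, Real.norm_eq_abs, one_mul,
                  mul_one, sq_abs, Real.sq_sqrt hr0.le]
              rw [← ENNReal.ofReal_mul (complexGaussianPDF_nonneg P'.coe_nonneg _),
                ← ENNReal.ofReal_mul (by norm_num),
                exp_logPosteriorRatio_polar hα hβ hs ht hP hr0 hv hnorm, hphase, gaussianPDF,
                ← ENNReal.ofReal_mul (mul_nonneg hβ.le (gaussianPDFReal_nonneg _ _ _))]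
          -- The Gaussian tails outside `(-π, π)`, and below outside `r > 0`, are added here; this
          -- is why the total mass is bounded by `1` rather than equal to it.
          _ ≤ ∫⁻ θ, ENNReal.ofReal (β * gaussianPDFReal y.2 t (β * r)) * gaussianPDF 0 v θ :=
              setLIntegral_le_lintegral _ _
          _ = _ := by
              rw [lintegral_const_mul _ (measurable_gaussianPDF _ _),
                lintegral_gaussianPDF_eq_one _ hv0, mul_one]
    _ ≤ ∫⁻ r, ENNReal.ofReal (β * gaussianPDFReal y.2 t (β * r)) := setLIntegral_le_lintegral _ _
    _ = 1 := lintegral_comp_const_mul_gaussianPDF hβ _ ht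

lemma logPosteriorRatio_channelMap {α β s t P : ℝ} (hP : 0 < P) {w : ℂ × ℂ × ℝ} (hw : w.1 ≠ 0) :
    logPosteriorRatio α β s t P (channelMap α β P w)
      = Real.log (2 * Real.pi * P * β) - Real.log (2 * Real.pi * t) / 2
        + (Real.log (α ^ 2 / (Real.pi * s)) + Real.log P) / 2 + Real.log (‖w.1‖ ^ 2) / 2
        + ‖w.1‖ ^ 2 - w.2.2 ^ 2 / (2 * t) - phasePenalty α s (1 / Real.sqrt P) w := by
  obtain ⟨x, z, n⟩ := w
  obtain ⟨r, hr, rfl⟩ : ∃ r : ℝ, 0 < r ∧ P = r ^ 2 :=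
    ⟨Real.sqrt P, Real.sqrt_pos.2 hP, (Real.sq_sqrt hP.le).symm⟩
  have hrc : (r : ℂ) ≠ 0 := by exact_mod_cast hr.ne'
  have hn : 0 < ‖x‖ := norm_pos_iff.2 hw
  simp only [logPosteriorRatio, channelMap, phasePenalty, Real.sqrt_sq hr.le]
  have hY : (α : ℂ) * r * x + z = r * (α * x + ((1 / r : ℝ) : ℂ) * z) := by
    push_cast; field_simp
  have hnr : ‖(r : ℂ) * x‖ ^ 2 = r ^ 2 * ‖x‖ ^ 2 := by
    rw [norm_mul, Complex.norm_real, mul_pow, Real.norm_eq_abs, sq_abs]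
  rw [hY, phaseGap_real_mul_right hr, phaseGap_real_mul_left hr, hnr,
    Real.log_mul (x := r ^ 2) (y := ‖x‖ ^ 2) (by positivity) (by positivity)]
  field_simp
  ring

/-- Lower bound for the mutual information of the splitting channel. -/
lemma le_klDiv_channelLaw {α β P : ℝ} {s t : ℝ≥0} (hα : 0 < α) (hβ : 0 < β) (hs : 0 < s)
    (ht : 0 < t) (hP : 0 < P)
    (hfin : klDiv (channelLaw α β P s t) ((inputLaw P).prod (channelLaw α β P s t).snd) ≠ ∞) :
    Real.log (2 * Real.pi * P * β) - Real.log (2 * Real.pi * t) / 2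
        + (Real.log (α ^ 2 / (Real.pi * s)) + Real.log P) / 2
        - Real.eulerMascheroniConstant / 2 + 1 / 2
        - ∫ w, phasePenalty α s (1 / Real.sqrt P) w ∂sourceLaw s t
      ≤ (klDiv (channelLaw α β P s t)
          ((inputLaw P).prod (channelLaw α β P s t).snd)).toReal := by
  have hm := measurable_logPosteriorRatio α β s t P
  have ht' : (0 : ℝ) < t := ht
  set C : ℝ := Real.log (2 * Real.pi * P * β) - Real.log (2 * Real.pi * t) / 2
        + (Real.log (α ^ 2 / (Real.pi * s)) + Real.log P) / 2
  have hcomp : ∀ᵐ w ∂sourceLaw s t, logPosteriorRatio α β s t P (channelMap α β P w)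
      = C + Real.log (‖w.1‖ ^ 2) / 2 + ‖w.1‖ ^ 2 - w.2.2 ^ 2 / (2 * t)
        - phasePenalty α s (1 / Real.sqrt P) w := by
    filter_upwards [ae_input_ne_zero] with w hw
    exact logPosteriorRatio_channelMap hP hw
  have hR : Integrable (phasePenalty α s (1 / Real.sqrt P)) (sourceLaw s t) :=
    integrable_phasePenalty t hα hs (by positivity)
  have h1 : Integrable (fun w : ℂ × ℂ × ℝ => C + Real.log (‖w.1‖ ^ 2) / 2) (sourceLaw s t) :=
    (integrable_const C).add ((integrable_log_input s t).div_const 2)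
  have h2 : Integrable (fun w : ℂ × ℂ × ℝ => C + Real.log (‖w.1‖ ^ 2) / 2 + ‖w.1‖ ^ 2)
      (sourceLaw s t) := h1.add (integrable_input_norm_sq s t)
  have hn := (integrable_real_noise_sq s t).div_const (2 * t)
  have h3 : Integrable (fun w : ℂ × ℂ × ℝ =>
      C + Real.log (‖w.1‖ ^ 2) / 2 + ‖w.1‖ ^ 2 - w.2.2 ^ 2 / (2 * t)) (sourceLaw s t) := h2.sub hn
  have hint : Integrable (logPosteriorRatio α β s t P) (channelLaw α β P s t) := by
    rw [channelLaw, integrable_map_measure hm.aestronglyMeasurable (by fun_prop)]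
    exact (h3.sub hR).congr (hcomp.mono fun w h => h.symm)
  have hexp : ∫⁻ p, ENNReal.ofReal (Real.exp (logPosteriorRatio α β s t P p))
      ∂((inputLaw P).prod (channelLaw α β P s t).snd) ≤ 1 := by
    rw [lintegral_prod_symm _ (by fun_prop)]
    refine (lintegral_mono fun y =>
      lintegral_exp_logPosteriorRatio_le hα hβ hs ht hP y).trans ?_
    simp
  refine le_trans (le_of_eq ?_) (integral_le_toReal_klDiv _ _ hfin hm hint hexp)
  rw [channelLaw, integral_map (by fun_prop) hm.aestronglyMeasurable, integral_congr_ae hcomp,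
    integral_sub h3 hR, integral_sub h2 hn, integral_add h1 (integrable_input_norm_sq s t),
    integral_add (integrable_const C) ((integrable_log_input s t).div_const 2), integral_div,
    integral_div, integral_log_input, integral_input_norm_sq, integral_real_noise_sq]
  simp only [integral_const, probReal_univ, one_smul]
  field_simp
  ring

/-! ### Reduction to the channel law, and asymptotics of the approximations -/

lemma Θ₁_pos {K : ℕ} {ρ : Fin K → ℝ} {h : Fin K → ℂ} (hρ : ∀ k, ρ k ∈ Set.Icc (0 : ℝ) 1)
    (hρ0 : ∃ k, h k ≠ 0 ∧ ρ k ≠ 0) : 0 < Θ₁ ρ h := by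
  obtain ⟨k, hk, hk'⟩ := hρ0
  have h1 : 0 < ρ k := lt_of_le_of_ne (hρ k).1 hk'.symm
  have h2 : 0 < ‖h k‖ := norm_pos_iff.2 hk
  exact Finset.sum_pos' (fun i _ => mul_nonneg (hρ i).1 (by positivity))
    ⟨k, Finset.mem_univ k, by positivity⟩

lemma Θ₂_pos {K : ℕ} {ρ : Fin K → ℝ} {h : Fin K → ℂ}
    (hρ1 : ∃ k, h k ≠ 0 ∧ ρ k ≠ 1) : 0 < Θ₂ ρ h := by
  obtain ⟨k, hk, hk'⟩ := hρ1
  have h1 : 1 - ρ k ≠ 0 := sub_ne_zero.2 hk'.symm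
  have h2 : 0 < ‖h k‖ := norm_pos_iff.2 hk
  exact Finset.sum_pos' (fun i _ => by positivity) ⟨k, Finset.mem_univ k, by positivity⟩

/-- The two independence assumptions identify the joint law of the sources with `sourceLaw`;
everything else is a push-forward of it. -/
lemma mutualInfo_eq_klDiv_channelLaw {K : ℕ} (ρ : Fin K → ℝ) (h : Fin K → ℂ) {s t : ℝ≥0}
    {Ω : Type*} [MeasurableSpace Ω] (μ : Measure Ω) [IsProbabilityMeasure μ]
    {X Z : Ω → ℂ} {N : Ω → ℝ} (hX : HasLaw X (complexGaussian 1) μ)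
    (hZ : HasLaw Z (complexGaussian s) μ) (hN : HasLaw N (gaussianReal 0 t) μ)
    (hindep : IndepFun X (fun ω => (Z ω, N ω)) μ) (hindep' : IndepFun Z N μ) (P : ℝ) :
    mutualInfo μ (channelInput P X) (channelOutput ρ h P X Z N)
      = klDiv (channelLaw (Real.sqrt (Θ₁ ρ h)) (Real.sqrt (Θ₂ ρ h)) P s t)
        ((inputLaw P).prod
          (channelLaw (Real.sqrt (Θ₁ ρ h)) (Real.sqrt (Θ₂ ρ h)) P s t).snd) := by
  have hZN : AEMeasurable (fun ω => (Z ω, N ω)) μ := hZ.aemeasurable.prodMk hN.aemeasurable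
  have hsrc : μ.map (fun ω => (X ω, Z ω, N ω)) = sourceLaw s t := by
    rw [(indepFun_iff_map_prod_eq_prod_map_map hX.aemeasurable hZN).1 hindep,
      (indepFun_iff_map_prod_eq_prod_map_map hZ.aemeasurable hN.aemeasurable).1 hindep',
      hX.map_eq, hZ.map_eq, hN.map_eq, sourceLaw]
  have hmeas : AEMeasurable (fun ω => (X ω, Z ω, N ω)) μ := hX.aemeasurable.prodMk hZN
  have hjoint : μ.map (fun ω => (channelInput P X ω, channelOutput ρ h P X Z N ω))
      = channelLaw (Real.sqrt (Θ₁ ρ h)) (Real.sqrt (Θ₂ ρ h)) P s t := by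
    rw [channelLaw, ← hsrc, AEMeasurable.map_map_of_aemeasurable (by fun_prop) hmeas]
    rfl
  have hin : μ.map (channelInput P X) = inputLaw P := by
    rw [inputLaw, ← hX.map_eq, AEMeasurable.map_map_of_aemeasurable (by fun_prop) hX.aemeasurable]
    rfl
  have hout : μ.map (channelOutput ρ h P X Z N)
      = (channelLaw (Real.sqrt (Θ₁ ρ h)) (Real.sqrt (Θ₂ ρ h)) P s t).snd := by
    rw [channelLaw, ← hsrc, Measure.snd, Measure.map_map measurable_snd (by fun_prop),
      AEMeasurable.map_map_of_aemeasurable (by fun_prop) hmeas]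
    rfl
  rw [mutualInfo, hjoint, hin, hout]

lemma approxLog_eq {K : ℕ} {ρ : Fin K → ℝ} {h : Fin K → ℂ} {σ₁ σ₂ : ℝ≥0} (hΘ₁ : 0 < Θ₁ ρ h)
    (hΘ₂ : 0 < Θ₂ ρ h) (hσ₁ : 0 < σ₁) (hσ₂ : 0 < σ₂) {P : ℝ} (hP : 0 < P) :
    approxLog ρ h σ₁ σ₂ P = (Real.log 2 / 2 + 3 / 2 * Real.log P
      + (Real.log (Θ₁ ρ h) + Real.log (Θ₂ ρ h)) / 2 - Real.log σ₁ - Real.log σ₂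
      - Real.eulerMascheroniConstant / 2) / Real.log 2 := by
  have h1 : (0 : ℝ) < σ₁ := hσ₁
  have h2 : (0 : ℝ) < σ₂ := hσ₂
  have h3 : 0 < P ^ (3 / 2 : ℝ) := Real.rpow_pos_of_pos hP _
  have hl : Real.log 2 ≠ 0 := (Real.log_pos one_lt_two).ne'
  rw [approxLog, Real.logb, Real.log_div (by positivity) (by positivity),
    Real.log_mul (by positivity) (by positivity), Real.log_mul (by positivity) (by positivity),
    Real.log_mul h1.ne' h2.ne', Real.log_sqrt zero_le_two, Real.log_sqrt (by positivity),
    Real.log_rpow hP, Real.log_mul hΘ₁.ne' hΘ₂.ne']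
  field_simp
  ring

lemma approxEi_eq {K : ℕ} {ρ : Fin K → ℝ} {h : Fin K → ℂ} {σ₁ σ₂ : ℝ≥0} {P : ℝ} :
    approxEi ρ h σ₁ σ₂ P = (Real.log (Θ₁ ρ h * P / (σ₁ : ℝ) ^ 2)
      + Real.exp (eiArg ρ h σ₁ σ₂ P) * Ei (eiArg ρ h σ₁ σ₂ P) / 2) / Real.log 2 := by
  have hl : Real.log 2 ≠ 0 := (Real.log_pos one_lt_two).ne'
  rw [approxEi, Real.logb]
  field_simp

lemma tendsto_eiArg {K : ℕ} {ρ : Fin K → ℝ} {h : Fin K → ℂ} {σ₁ σ₂ : ℝ≥0} (hΘ₁ : 0 < Θ₁ ρ h)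
    (hΘ₂ : 0 < Θ₂ ρ h) (hσ₁ : 0 < σ₁) (hσ₂ : 0 < σ₂) :
    Tendsto (eiArg ρ h σ₁ σ₂) atTop (𝓝[>] 0) := by
  have h1 : (0 : ℝ) < σ₁ := hσ₁
  have h2 : (0 : ℝ) < σ₂ := hσ₂
  refine tendsto_nhdsWithin_iff.2 ⟨?_, ?_⟩
  · unfold eiArg
    exact tendsto_const_nhds.div_atTop (tendsto_id.const_mul_atTop (by positivity))
  · filter_upwards [eventually_gt_atTop 0] with P hP
    rw [Set.mem_Ioi, eiArg]
    positivity

lemma tendsto_approxEi_sub_approxLog {K : ℕ} {ρ : Fin K → ℝ} {h : Fin K → ℂ} {σ₁ σ₂ : ℝ≥0}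
    (hΘ₁ : 0 < Θ₁ ρ h) (hΘ₂ : 0 < Θ₂ ρ h) (hσ₁ : 0 < σ₁) (hσ₂ : 0 < σ₂) :
    Tendsto (fun P : ℝ => approxEi ρ h σ₁ σ₂ P - approxLog ρ h σ₁ σ₂ P) atTop (𝓝 0) := by
  have h1 : (0 : ℝ) < σ₁ := hσ₁
  have h2 : (0 : ℝ) < σ₂ := hσ₂
  have hl : Real.log 2 ≠ 0 := (Real.log_pos one_lt_two).ne'
  have hlim := ((tendsto_exp_mul_Ei_add_log.comp (tendsto_eiArg hΘ₁ hΘ₂ hσ₁ hσ₂)).add_const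
    Real.eulerMascheroniConstant).div_const (2 * Real.log 2)
  rw [neg_add_cancel, zero_div] at hlim
  refine hlim.congr' ?_
  filter_upwards [eventually_gt_atTop 0] with P hP
  have hc : Real.log (eiArg ρ h σ₁ σ₂ P) = Real.log (Θ₁ ρ h) + 2 * Real.log σ₂
      - (Real.log 2 + Real.log (Θ₂ ρ h) + 2 * Real.log σ₁ + Real.log P) := by
    rw [eiArg, Real.log_div (by positivity) (by positivity), Real.log_mul hΘ₁.ne' (by positivity),
      Real.log_mul (by positivity) hP.ne', Real.log_mul (by positivity) (by positivity),
      Real.log_mul two_ne_zero hΘ₂.ne', Real.log_pow, Real.log_pow]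
    push_cast
    ring
  simp only [Function.comp_apply]
  rw [approxLog_eq hΘ₁ hΘ₂ hσ₁ hσ₂ hP, approxEi_eq, hc,
    Real.log_div (by positivity) (by positivity), Real.log_mul hΘ₁.ne' hP.ne', Real.log_pow]
  push_cast
  field_simp
  ring

lemma tendsto_approxLog_div_logb {K : ℕ} {ρ : Fin K → ℝ} {h : Fin K → ℂ} {σ₁ σ₂ : ℝ≥0}
    (hΘ₁ : 0 < Θ₁ ρ h) (hΘ₂ : 0 < Θ₂ ρ h) (hσ₁ : 0 < σ₁) (hσ₂ : 0 < σ₂) :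
    Tendsto (fun P : ℝ => approxLog ρ h σ₁ σ₂ P / Real.logb 2 P) atTop (𝓝 (3 / 2)) := by
  have hl : Real.log 2 ≠ 0 := (Real.log_pos one_lt_two).ne'
  have hlim := (Real.tendsto_log_atTop.const_div_atTop (Real.log 2 / 2
      + (Real.log (Θ₁ ρ h) + Real.log (Θ₂ ρ h)) / 2 - Real.log σ₁ - Real.log σ₂
      - Real.eulerMascheroniConstant / 2)).const_add (3 / 2)
  rw [add_zero] at hlim
  refine hlim.congr' ?_
  filter_upwards [eventually_gt_atTop 1] with P hP
  have hlP : Real.log P ≠ 0 := (Real.log_pos hP).ne'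
  rw [approxLog_eq hΘ₁ hΘ₂ hσ₁ hσ₂ (by linarith), Real.logb]
  field_simp
  ring

end SplittingReceiver

/-! ### The squeeze -/

open SplittingReceiver in
theorem lemma1 {K : ℕ} (ρ : Fin K → ℝ) (h : Fin K → ℂ) (σ₁ σ₂ : ℝ≥0)
    (hρ : ∀ k, ρ k ∈ Set.Icc (0 : ℝ) 1)
    (hρ0 : ∃ k, h k ≠ 0 ∧ ρ k ≠ 0) (hρ1 : ∃ k, h k ≠ 0 ∧ ρ k ≠ 1)
    (hσ₁ : 0 < σ₁) (hσ₂ : 0 < σ₂)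
    {Ω : Type*} [MeasurableSpace Ω] (μ : Measure Ω) [IsProbabilityMeasure μ]
    (X Z : Ω → ℂ) (N : Ω → ℝ)
    (hX : HasLaw X (complexGaussian 1) μ)
    (hZ : HasLaw Z (complexGaussian (σ₁ ^ 2)) μ)
    (hN : HasLaw N (gaussianReal 0 (σ₂ ^ 2)) μ)
    (hindep : IndepFun X (fun ω => (Z ω, N ω)) μ) (hindep' : IndepFun Z N μ) :
    (∀ P : ℝ, 0 < P →
      mutualInfo μ (channelInput P X) (channelOutput ρ h P X Z N) ≠ ∞) ∧
    Tendsto (fun P : ℝ =>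
        mutualInfoBits μ (channelInput P X) (channelOutput ρ h P X Z N)
          - approxEi ρ h σ₁ σ₂ P) atTop (𝓝 0) ∧
    Tendsto (fun P : ℝ => approxEi ρ h σ₁ σ₂ P - approxLog ρ h σ₁ σ₂ P) atTop (𝓝 0) ∧
    Tendsto (fun P : ℝ =>
        mutualInfoBits μ (channelInput P X) (channelOutput ρ h P X Z N) / Real.logb 2 P)
      atTop (𝓝 (3 / 2)) := by
  have hΘ₁ := Θ₁_pos hρ hρ0
  have hΘ₂ := Θ₂_pos hρ1
  have h1 : (0 : ℝ) < σ₁ := hσ₁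
  have h2 : (0 : ℝ) < σ₂ := hσ₂
  have hl : 0 < Real.log 2 := Real.log_pos one_lt_two
  obtain ⟨α, hα⟩ : ∃ α, α = Real.sqrt (Θ₁ ρ h) := ⟨_, rfl⟩
  obtain ⟨β, hβ⟩ : ∃ β, β = Real.sqrt (Θ₂ ρ h) := ⟨_, rfl⟩
  have hα0 : 0 < α := hα ▸ Real.sqrt_pos.2 hΘ₁
  have hβ0 : 0 < β := hβ ▸ Real.sqrt_pos.2 hΘ₂
  have hα2 : Θ₁ ρ h = α ^ 2 := by rw [hα, Real.sq_sqrt hΘ₁.le]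
  have hβ2 : Θ₂ ρ h = β ^ 2 := by rw [hβ, Real.sq_sqrt hΘ₂.le]
  have hs : 0 < σ₁ ^ 2 := by positivity
  have ht : 0 < σ₂ ^ 2 := by positivity
  obtain ⟨k, hk⟩ : ∃ k : ℝ, k = 2 * β ^ 2 * ((σ₁ ^ 2 : ℝ≥0) : ℝ) / α ^ 4 := ⟨_, rfl⟩
  have hMI := mutualInfo_eq_klDiv_channelLaw ρ h μ hX hZ hN hindep hindep'
  rw [← hα, ← hβ] at hMI
  have hupper := fun P hP => klDiv_channelLaw_le (P := P) hα0 hβ0 hs ht hk hP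
  have hfin : ∀ P : ℝ, 0 < P →
      mutualInfo μ (channelInput P X) (channelOutput ρ h P X Z N) ≠ ∞ := fun P hP => by
    rw [hMI]
    exact (hupper P hP).1
  have hdiff := tendsto_approxEi_sub_approxLog hΘ₁ hΘ₂ hσ₁ hσ₂
  have hε : Tendsto (fun P : ℝ => 1 / Real.sqrt P) atTop (𝓝[>] 0) := by
    refine tendsto_nhdsWithin_iff.2 ⟨tendsto_const_nhds.div_atTop Real.tendsto_sqrt_atTop, ?_⟩
    filter_upwards [eventually_gt_atTop 0] with P hP
    rw [Set.mem_Ioi]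
    positivity
  have hU := ((tendsto_integral_upperResidual hα0 hβ0 hs ht hk).comp hε).div_const (Real.log 2)
  have hV := (((tendsto_integral_phasePenalty (σ₂ ^ 2) hα0 hs).comp hε).const_sub
    (1 / 2)).div_const (Real.log 2)
  rw [zero_div] at hU
  rw [sub_self, zero_div] at hV
  -- The lower bound controls the distance to `approxLog`; subtracting `approxEi - approxLog`
  -- converts it to the distance to `approxEi`.
  have hL := hV.sub hdiff
  rw [sub_zero] at hL
  have hmain : Tendsto (fun P : ℝ =>
      mutualInfoBits μ (channelInput P X) (channelOutput ρ h P X Z N)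
        - approxEi ρ h σ₁ σ₂ P) atTop (𝓝 0) := by
    refine tendsto_of_tendsto_of_tendsto_of_le_of_le' hL hU ?_ ?_
    · filter_upwards [eventually_gt_atTop 0] with P hP
      have hlow := le_klDiv_channelLaw hα0 hβ0 hs ht hP (hupper P hP).1
      simp only [Function.comp_apply]
      rw [mutualInfoBits, hMI, approxLog_eq hΘ₁ hΘ₂ hσ₁ hσ₂ hP, sub_sub_eq_add_sub,
        sub_le_sub_iff_right, ← add_div, div_le_div_iff_of_pos_right hl]
      refine le_trans (le_of_eq ?_) hlow
      have hpi := Real.pi_pos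
      rw [hα2, hβ2]
      push_cast
      -- The contributions of `log π` cancel and `½ log 2` remains, matching the `√2` in
      -- `approxLog`.
      rw [Real.log_mul (by positivity) hβ0.ne', Real.log_mul (by positivity) hP.ne',
        Real.log_mul two_ne_zero hpi.ne', Real.log_mul (by positivity) (by positivity),
        Real.log_mul two_ne_zero hpi.ne', Real.log_div (by positivity) (by positivity),
        Real.log_mul hpi.ne' (by positivity)]
      simp only [Real.log_pow]
      push_cast
      ring
    · filter_upwards [eventually_gt_atTop 0] with P hP
      have hup := (hupper P hP).2
      simp only [Function.comp_apply]
      have hc : eiArg ρ h σ₁ σ₂ P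
          = ((σ₂ ^ 2 : ℝ≥0) : ℝ) / (k * α ^ 2 * P) := by
        rw [eiArg, hk, hα2, hβ2]
        push_cast
        field_simp
      rw [mutualInfoBits, hMI, approxEi_eq, hc, hα2, ← sub_div, div_le_div_iff_of_pos_right hl]
      push_cast at hup ⊢
      linarith
  refine ⟨hfin, hmain, hdiff, ?_⟩
  have hlogb : Tendsto (fun P : ℝ => Real.logb 2 P) atTop atTop :=
    Real.tendsto_logb_atTop one_lt_two
  -- The ratio is split through `approxEi` and `approxLog`; the two vanishing differences stay
  -- negligible after division.
  have hsum := ((hmain.div_atTop hlogb).add (hdiff.div_atTop hlogb)).add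
    (tendsto_approxLog_div_logb hΘ₁ hΘ₂ hσ₁ hσ₂)
  rw [zero_add, zero_add] at hsum
  refine hsum.congr fun P => ?_
  rw [← add_div, ← add_div]
  congr 1
  ring
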